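/- Let $G$ be a finite group, $p$ a prime and $P\in\operatorname{Syl}_p(G)$. Write $\operatorname{Irr}_{p'}(G)$ for the set of complex irreducible characters of $G$ of degree not divisible by $p$, and $\mathbb{Q}_n$ for the field generated over $\mathbb{Q}$ by a primitive $n$-th root of unity. For $\chi\in\operatorname{Irr}(G)$ let $c(\chi)$ be the smallest positive integer $n$ such that all values of $\chi$ lie in $\mathbb{Q}_n$; $\chi$ is called $p$-rational if $p\nmid c(\chi)$, and almost $p$-rational if $p^2\nmid c(\chi)$. Suppose that $G$ satisfies the McKay–Navarro conjecture for $p$, that is: whenever $e\ge 0$ is an integer and $\sigma\in\operatorname{Gal}(\mathbb{Q}_{|G|}/\mathbb{Q})$ satisfies $\sigma(\xi)=\xi^{p^e}$ for every root of unity $\xi\in\mathbb{Q}_{|G|}$ of order prime to $p$, the numbers of $\sigma$-invariant characters in $\operatorname{Irr}_{p'}(G)$ and in $\operatorname{Irr}_{p'}(\mathbf{N}_G(P))$ are equal. Then Conjecture B holds for $G$ and $p$: with $K=\mathbf{N}_G(P)/\Phi(P)$ and $Q=P/\Phi(P)$, where $\Phi(P)$ is the Frattini subgroup of $P$, the following are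 equivalent. (i) Every almost $p$-rational $\chi\in\operatorname{Irr}_{p'}(G)$ is $p$-rational. (ii) For every $1\ne y\in Q$: (a) $\mathbf{N}_K(\langle y\rangle)/\mathbf{C}_K(y)\cong\operatorname{Aut}(\langle y\rangle)$, and (b) $\mathbf{N}_K(\langle y\rangle)/Q$ acts trivially (by conjugation) on the set of conjugacy classes of $\mathbf{C}_K(y)/Q$. -/

import Mathlib

noncomputable section

namespace McKayGap

/-! ### Irreducible characters and conductors -/

/-- The complex irreducible characters of `G`, as functions `G → ℂ`: the traces of the irreducible
representations of `G` on the spaces `ℂ ^ d`. -/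
def Irr (G : Type*) [Group G] : Set (G → ℂ) :=
  {χ | ∃ (d : ℕ) (ρ : Representation ℂ G (Fin d → ℂ)), ρ.IsIrreducible ∧ ρ.character = χ}

/-- The irreducible characters of `G` whose degree `χ 1` is not divisible by `p`. -/
def IrrPrime (p : ℕ) (G : Type*) [Group G] : Set (G → ℂ) :=
  {χ | χ ∈ Irr G ∧ ∃ d : ℕ, χ 1 = d ∧ ¬ p ∣ d}

/-- The cyclotomic field `ℚ_n` inside `ℂ`, generated by the primitive `n`-th root of unity
`exp (2 π i / n)`. -/
def cyclo (n : ℕ) : IntermediateField ℚ ℂ :=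
  IntermediateField.adjoin ℚ {Complex.exp (2 * Real.pi * Complex.I / n)}

/-- The field of values `ℚ(χ)`. -/
def valueField {G : Type*} (χ : G → ℂ) : IntermediateField ℚ ℂ :=
  IntermediateField.adjoin ℚ (Set.range χ)

/-- The conductor of an abelian number field: the least positive `n` with `K ⊆ ℚ_n`. -/
def fieldConductor (K : IntermediateField ℚ ℂ) : ℕ := sInf {n : ℕ | 0 < n ∧ K ≤ cyclo n}

/-- The `p`-rationality level of a character `χ`: the exponent of the exact power of `p` dividing
the conductor of `ℚ(χ)`. -/
def rationalityLevel (p : ℕ) {G : Type*} (χ : G → ℂ) : ℕ :=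
  (fieldConductor (valueField χ)).factorization p

/-- `χ` is `p`-rational. -/
def IsPRational (p : ℕ) {G : Type*} (χ : G → ℂ) : Prop := rationalityLevel p χ = 0

/-- `χ` is almost `p`-rational. -/
def IsAlmostPRational (p : ℕ) {G : Type*} (χ : G → ℂ) : Prop := rationalityLevel p χ ≤ 1

/-! ### The McKay–Navarro conjecture -/

/-- `χ` is invariant under the automorphism `σ` of `ℚ_n`: every value of `χ` is an element of
`ℚ_n` fixed by `σ`. (Irreducible characters of `G` and of its subgroups take their values in
`ℚ_n` for `n = |G|`.) -/
def IsGaloisInvariant {n : ℕ} (σ : cyclo n ≃ₐ[ℚ] cyclo n) {G : Type*} (χ : G → ℂ) : Prop :=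
  ∀ g, ∃ x : cyclo n, (x : ℂ) = χ g ∧ σ x = x

/-- The automorphism `σ` of `ℚ_n` sends every root of unity of order prime to `p` in `ℚ_n` to its
`p ^ e`-th power. -/
def ActsAsFrobeniusPow (p e : ℕ) {n : ℕ} (σ : cyclo n ≃ₐ[ℚ] cyclo n) : Prop :=
  ∀ (k : ℕ) (ξ : cyclo n), ¬ p ∣ k → ξ ^ k = 1 → σ ξ = ξ ^ (p ^ e)

/-- `G` satisfies the McKay–Navarro conjecture for the prime `p` (where `P` is a Sylow
`p`-subgroup): every `σ ∈ Gal(ℚ_{|G|}/ℚ)` for which there is `e ≥ 0` such that `σ` sends all roots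
of unity of order prime to `p` to their `p ^ e`-th power fixes the same number of irreducible
characters of degree prime to `p` of `G` and of `N_G(P)`. -/
def SatisfiesMcKayNavarro {p : ℕ} {G : Type*} [Group G] (P : Sylow p G) : Prop :=
  ∀ (e : ℕ) (σ : cyclo (Nat.card G) ≃ₐ[ℚ] cyclo (Nat.card G)), ActsAsFrobeniusPow p e σ →
    {χ | χ ∈ IrrPrime p G ∧ IsGaloisInvariant σ χ}.encard =
      {ψ | ψ ∈ IrrPrime p (Subgroup.normalizer (P : Set G)) ∧ IsGaloisInvariant σ ψ}.encard

/-! ### The local condition -/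

section Local

variable {K : Type*} [Group K]

theorem conj_mem_centralizer {y n c : K}
    (hn : n ∈ Subgroup.normalizer (Subgroup.zpowers y : Set K))
    (hc : c ∈ Subgroup.centralizer {y}) : n * c * n⁻¹ ∈ Subgroup.centralizer {y} := by
  rw [Subgroup.mem_centralizer_singleton_iff] at hc ⊢
  have h1 : n⁻¹ * y * n ∈ Subgroup.zpowers y :=
    (Subgroup.mem_normalizer_iff''.mp hn y).mp (Subgroup.mem_zpowers y)
  obtain ⟨k, hk⟩ := Subgroup.mem_zpowers_iff.mp h1
  have hc' : Commute c (n⁻¹ * y * n) := hk ▸ Commute.zpow_right hc k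
  have h2 : c * (n⁻¹ * y * n) = (n⁻¹ * y * n) * c := hc'
  calc n * c * n⁻¹ * y = n * (c * (n⁻¹ * y * n)) * n⁻¹ := by group
    _ = n * ((n⁻¹ * y * n) * c) * n⁻¹ := by rw [h2]
    _ = y * (n * c * n⁻¹) := by group

/-- `C_K(y)` is normal in `N_K(⟨y⟩)`. -/
instance centralizer_normal (y : K) :
    ((Subgroup.centralizer {y}).subgroupOf
      (Subgroup.normalizer (Subgroup.zpowers y : Set K))).Normal :=
  ⟨fun _ hc n => conj_mem_centralizer n.2 hc⟩

/-- `N_K(⟨y⟩) / C_K(y) ≅ Aut(⟨y⟩)`. -/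
def NormalizerInducesAut (y : K) : Prop :=
  Nonempty ((Subgroup.normalizer (Subgroup.zpowers y : Set K) ⧸
      (Subgroup.centralizer {y}).subgroupOf
        (Subgroup.normalizer (Subgroup.zpowers y : Set K))) ≃*
    MulAut (Subgroup.zpowers y))

/-- For a normal subgroup `Q ≤ C_K(y)` of `K`: the conjugation action of `N_K(⟨y⟩) / Q` on
`C_K(y) / Q` fixes every conjugacy class of `C_K(y) / Q`, that is, for `n ∈ N_K(⟨y⟩)` and
`c ∈ C_K(y)`, the cosets of `n c n⁻¹` and `c` have the same class in `C_K(y) / Q`. -/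
def NormalizerFixesClasses (Q : Subgroup K) [Q.Normal] (y : K) : Prop :=
  ∀ (n : K) (hn : n ∈ Subgroup.normalizer (Subgroup.zpowers y : Set K))
    (c : K) (hc : c ∈ Subgroup.centralizer {y}),
    ConjClasses.mk (QuotientGroup.mk' (Q.subgroupOf (Subgroup.centralizer {y}))
        ⟨n * c * n⁻¹, conj_mem_centralizer hn hc⟩) =
      ConjClasses.mk (QuotientGroup.mk' (Q.subgroupOf (Subgroup.centralizer {y})) ⟨c, hc⟩)

end Local

section Quotient

variable {p : ℕ} {G : Type*} [Group G] (P : Sylow p G)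

/-- The normal subgroup `P` of `N_G(P)`. -/
abbrev sylowInNormalizer : Subgroup (Subgroup.normalizer (P : Set G)) :=
  (P : Subgroup G).subgroupOf (Subgroup.normalizer (P : Set G))

instance sylowInNormalizer_normal : (sylowInNormalizer P).Normal :=
  Subgroup.normal_in_normalizer

/-- The Frattini subgroup `Φ(P)`, as a (normal) subgroup of `N_G(P)`. -/
abbrev frattiniInNormalizer : Subgroup (Subgroup.normalizer (P : Set G)) :=
  (frattini (sylowInNormalizer P)).map (sylowInNormalizer P).subtype

/-- The group `K = N_G(P) / Φ(P)`. -/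
abbrev localQuotient : Type _ :=
  Subgroup.normalizer (P : Set G) ⧸ frattiniInNormalizer P

/-- The subgroup `Q = P / Φ(P)` of `K = N_G(P) / Φ(P)`. -/
abbrev frattiniQuotient : Subgroup (localQuotient P) :=
  (sylowInNormalizer P).map (QuotientGroup.mk' (frattiniInNormalizer P))

instance frattiniQuotient_normal : (frattiniQuotient P).Normal :=
  Subgroup.Normal.map inferInstance _ (QuotientGroup.mk'_surjective _)

end Quotient

end McKayGap

end

/-!
The idea is to compare two Galois automorphisms. Write `|G| = p ^ a * m` with `p ∤ m`.

For odd `p` and `a > 0`, take `k ≡ 1` modulo `m` that is a primitive root modulo `p ^ a`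
(`exists_primitiveRoot`), and let `σ` and `τ = σ ^ (p - 1)` be the automorphisms of `ℚ_|G|` that
raise the roots of unity to the powers `k` and `k ^ (p - 1)`. Both fix the roots of unity of order
prime to `p`, so that the McKay–Navarro hypothesis applies to them with `e = 0`. Since
`ℚ_a ∩ ℚ_b = ℚ_(gcd a b)` (`cyclo_inf_le`), a character of `G` is `p`-rational if and only if its
values lie in `ℚ_m`, the fixed field of `σ`, and almost `p`-rational if and only if they lie in
`ℚ_(p m)`, the fixed field of `τ`. So condition (i) says that every `τ`-invariant character of
degree prime to `p` is `σ`-invariant. Both sets are finite and the second is contained in the first;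
their sizes for `G` and for `N_G(P)` agree, so (i) holds for `G` if and only if the analogous
statement about invariance holds for `N_G(P)` (`subset_iff_subset_of_encard_eq`).

For `N_G(P)`, the `τ`-invariant irreducible characters of degree prime to `p` are exactly the
irreducible characters of `K = N_G(P) / Φ(P)` (`forall_character_pow_eq_iff_isConj`). In one
direction, such a character restricted to `P` has a linear constituent fixed by `u ↦ u ^ (1 + p)`,
which is therefore trivial on `Φ(P)`; by normality of `Φ(P)` the whole representation is trivial
there (`frattini_acts_trivially`). In the other, the abelian normal subgroup `Q = P / Φ(P)` has
index prime to `p` in `K`, and Itô's theorem (`finrank_dvd_index`) says that the degrees divide this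
index; and `k ^ (p - 1) ≡ 1` modulo the exponent of `K`. Since `σ` sends `χ(g)` to `χ(g ^ k)` and the
irreducible characters separate conjugacy classes (`isConj_of_forall_Irr`), condition (i) becomes:
every `g ∈ K` is conjugate to `g ^ k`.

This last statement is equivalent to (ii) by group theory (`forall_isConj_pow_iff`): write
`g = x y` with commuting `x` of order prime to `p` and `y ∈ Q`; then `g ^ k = x * y ^ k`, and a
conjugating element normalizes `⟨y⟩`, inducing `y ↦ y ^ k` and fixing the class of `x` in
`C_K(y) / Q`. Conjugacy modulo `Q` is lifted to conjugacy of elements of order prime to `p` by a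
Schur–Zassenhaus argument (`exists_conj_eq_of_mem_coset`).

If `p ∤ |G|`, both conditions hold trivially. If `p = 2`, both hold as well: a conductor is never
`2` modulo `4`, and an element `y` of order two satisfies `N_K(⟨y⟩) = C_K(y)`.
-/

noncomputable section

namespace McKayGap

/-! ### Cyclotomic fields inside `ℂ` -/

/-- The primitive `n`-th root of unity `exp (2 π i / n)`, as an element of `ℚ_n`. -/
def cycloRoot (n : ℕ) : cyclo n :=
  ⟨Complex.exp (2 * Real.pi * Complex.I / n), IntermediateField.mem_adjoin_simple_self ℚ _⟩

theorem isPrimitiveRoot_cycloRoot (n : ℕ) [NeZero n] : IsPrimitiveRoot (cycloRoot n) n :=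
  IsPrimitiveRoot.of_map_of_injective (f := (cyclo n).val)
    (Complex.isPrimitiveRoot_exp n (NeZero.ne n)) (cyclo n).val.injective

instance isCyclotomicExtension_cyclo (n : ℕ) [NeZero n] :
    IsCyclotomicExtension {n} ℚ (cyclo n) := by
  have h := Complex.isPrimitiveRoot_exp n (NeZero.ne n)
  change IsCyclotomicExtension {n} ℚ (cyclo n).toSubalgebra
  rw [cyclo, IntermediateField.adjoin_simple_toSubalgebra_of_isAlgebraic]
  · exact h.adjoin_isCyclotomicExtension ℚ
  · exact (h.isIntegral (NeZero.pos n)).tower_top.isAlgebraic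

instance (n : ℕ) [NeZero n] : NumberField (cyclo n) :=
  IsCyclotomicExtension.numberField {n} ℚ (cyclo n)

theorem mem_cyclo_of_pow_eq_one {n : ℕ} [NeZero n] {z : ℂ} (hz : z ^ n = 1) : z ∈ cyclo n := by
  obtain ⟨i, -, rfl⟩ := (Complex.isPrimitiveRoot_exp n (NeZero.ne n)).eq_pow_of_pow_eq_one hz
  exact pow_mem (cycloRoot n).2 i

theorem cyclo_mono {d n : ℕ} [NeZero n] (h : d ∣ n) : cyclo d ≤ cyclo n := by
  have : NeZero d := ⟨fun h0 => NeZero.ne n (by simpa [h0] using h)⟩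
  rw [cyclo, IntermediateField.adjoin_simple_le_iff]
  apply mem_cyclo_of_pow_eq_one
  obtain ⟨e, rfl⟩ := h
  rw [pow_mul, (Complex.isPrimitiveRoot_exp d (NeZero.ne d)).pow_eq_one, one_pow]

theorem exists_algEquiv_cycloRoot (n t : ℕ) [NeZero n] (ht : t.Coprime n) :
    ∃ σ : cyclo n ≃ₐ[ℚ] cyclo n, σ (cycloRoot n) = cycloRoot n ^ t := by
  refine ⟨(IsCyclotomicExtension.Rat.galEquivZMod n (cyclo n)).symm (ZMod.unitOfCoprime t ht), ?_⟩
  rw [IsCyclotomicExtension.Rat.galEquivZMod_apply_of_pow_eq n (cyclo n) _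
    (isPrimitiveRoot_cycloRoot n).pow_eq_one, MulEquiv.apply_symm_apply]
  rw [ZMod.coe_unitOfCoprime, ZMod.val_natCast]
  conv_rhs => rw [← Nat.mod_add_div t n, pow_add, pow_mul,
    (isPrimitiveRoot_cycloRoot n).pow_eq_one, one_pow, mul_one]

theorem exists_pow_cycloRoot (n : ℕ) [NeZero n] (σ : cyclo n ≃ₐ[ℚ] cyclo n) :
    ∃ t : ℕ, t.Coprime n ∧ σ (cycloRoot n) = cycloRoot n ^ t := by
  have h := isPrimitiveRoot_cycloRoot n
  have h' : IsPrimitiveRoot (σ (cycloRoot n)) n := h.map_of_injective σ.injective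
  obtain ⟨i, -, hc, hi⟩ := h.isPrimitiveRoot_iff.mp h'
  exact ⟨i, hc, hi.symm⟩

theorem coprime_of_algEquiv_cycloRoot {n t : ℕ} [NeZero n] {σ : cyclo n ≃ₐ[ℚ] cyclo n}
    (hσ : σ (cycloRoot n) = cycloRoot n ^ t) : t.Coprime n := by
  have h := isPrimitiveRoot_cycloRoot n
  have h' : IsPrimitiveRoot (σ (cycloRoot n)) n := h.map_of_injective σ.injective
  rw [hσ] at h'
  exact (h.pow_iff_coprime (NeZero.pos n) t).mp h'

theorem isPrimitiveRoot_pow_eq_pow_iff {M : Type*} [CommMonoid M] {ζ : M} {n : ℕ} [NeZero n]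
    (h : IsPrimitiveRoot ζ n) {i j : ℕ} : ζ ^ i = ζ ^ j ↔ i ≡ j [MOD n] := by
  rw [(h.isOfFinOrder (NeZero.ne n)).pow_eq_pow_iff_modEq, ← h.eq_orderOf]

/-- The subfield generated by the `d`-th roots of unity in the `n`-th cyclotomic field, `d ∣ n`, is
fixed by exactly those automorphisms that raise `n`-th roots of unity to a power congruent to `1`
modulo `d`. -/
theorem mem_range_iff_of_isCyclotomicExtension {d n : ℕ} [NeZero d] [NeZero n] (h : d ∣ n)
    {D E : Type*} [Field D] [Field E] [NumberField D] [NumberField E]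
    [IsCyclotomicExtension {d} ℚ D] [IsCyclotomicExtension {n} ℚ E]
    (f : D →ₐ[ℚ] E) {ζ : E} (hζ : IsPrimitiveRoot ζ n) (x : E) :
    x ∈ Set.range f ↔ ∀ (σ : E ≃ₐ[ℚ] E) (t : ℕ), σ ζ = ζ ^ t → t ≡ 1 [MOD d] → σ x = x := by
  have : IsGalois ℚ E := IsCyclotomicExtension.isGalois {n} ℚ E
  have hy := IsCyclotomicExtension.zeta_spec d ℚ D
  set y := IsCyclotomicExtension.zeta d ℚ D
  have hz : IsPrimitiveRoot (f y) d := hy.map_of_injective f.injective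
  have hzn : f y ^ n = 1 := by
    obtain ⟨e, rfl⟩ := h
    rw [pow_mul, hz.pow_eq_one, one_pow]
  have hfix : ∀ (σ : E ≃ₐ[ℚ] E) (t : ℕ), σ ζ = ζ ^ t → (σ (f y) = f y ↔ t ≡ 1 [MOD d]) := by
    intro σ t hσ
    obtain ⟨i, -, hi⟩ := hζ.eq_pow_of_pow_eq_one hzn
    have h1 : σ (f y) = f y ^ t := by
      rw [← hi, map_pow, hσ, ← pow_mul, ← pow_mul, mul_comm]
    rw [h1]
    conv_lhs => rhs; rw [← pow_one (f y)]
    exact isPrimitiveRoot_pow_eq_pow_iff hz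
  have hmem : x ∈ Set.range f ↔ x ∈ f.fieldRange := Iff.rfl
  rw [hmem, ← IsGalois.fixedField_fixingSubgroup f.fieldRange, IntermediateField.mem_fixedField_iff]
  constructor
  · intro hx σ t hσ ht
    refine hx σ ((IntermediateField.mem_fixingSubgroup_iff _ σ).mpr ?_)
    rintro _ ⟨w, rfl⟩
    have hext : (σ : E →ₐ[ℚ] E).comp f = f := by
      refine (hy.powerBasis ℚ).algHom_ext ?_
      rw [IsPrimitiveRoot.powerBasis_gen]
      exact (hfix σ t hσ).mpr ht
    exact DFunLike.congr_fun hext w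
  · intro hx σ hσ
    have hσζ : IsPrimitiveRoot (σ ζ) n := hζ.map_of_injective σ.injective
    obtain ⟨t, -, -, ht⟩ := hζ.isPrimitiveRoot_iff.mp hσζ
    exact hx σ t ht.symm ((hfix σ t ht.symm).mp
      ((IntermediateField.mem_fixingSubgroup_iff _ σ).mp hσ _ ⟨y, rfl⟩))

theorem coe_mem_iff_mem_range_inclusion {A B : IntermediateField ℚ ℂ} (hle : A ≤ B) (x : B) :
    (x : ℂ) ∈ A ↔ x ∈ Set.range (IntermediateField.inclusion hle).toRingHom.toRatAlgHom :=
  ⟨fun hx => ⟨⟨x, hx⟩, rfl⟩, fun ⟨y, hy⟩ => hy ▸ y.2⟩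

/-- Galois descent between cyclotomic fields: for `d ∣ n`, an element of `ℚ_n` lies in `ℚ_d` if and
only if it is fixed by the automorphisms that raise `n`-th roots of unity to a power congruent to
`1` modulo `d`. -/
theorem coe_mem_cyclo_iff {d n : ℕ} [NeZero n] (h : d ∣ n) (x : cyclo n) :
    (x : ℂ) ∈ cyclo d ↔ ∀ (σ : cyclo n ≃ₐ[ℚ] cyclo n) (t : ℕ),
      σ (cycloRoot n) = cycloRoot n ^ t → t ≡ 1 [MOD d] → σ x = x := by
  have : NeZero d := ⟨fun h0 => NeZero.ne n (by simpa [h0] using h)⟩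
  have hle : cyclo d ≤ cyclo n := cyclo_mono h
  rw [coe_mem_iff_mem_range_inclusion hle]
  exact mem_range_iff_of_isCyclotomicExtension h _ (isPrimitiveRoot_cycloRoot n) x

/-- `ℚ_a ∩ ℚ_b` lies in `ℚ_(gcd a b)`: an automorphism acting trivially on the latter is a product
of automorphisms acting trivially on `ℚ_a` and on `ℚ_b`. -/
theorem cyclo_inf_le (a b : ℕ) [NeZero a] [NeZero b] : cyclo a ⊓ cyclo b ≤ cyclo (a.gcd b) := by
  rintro x ⟨hxa, hxb⟩
  have : NeZero (a.lcm b) := ⟨Nat.lcm_ne_zero (NeZero.ne a) (NeZero.ne b)⟩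
  have hx : x ∈ cyclo (a.lcm b) := cyclo_mono (Nat.dvd_lcm_left a b) hxa
  have key : ∀ y : cyclo (a.lcm b), (y : ℂ) ∈ cyclo a → (y : ℂ) ∈ cyclo b →
      (y : ℂ) ∈ cyclo (a.gcd b) := by
    intro y ha hb
    rw [coe_mem_cyclo_iff ((Nat.gcd_dvd_left a b).trans (Nat.dvd_lcm_left a b))]
    intro σ t hσ ht
    rw [coe_mem_cyclo_iff (Nat.dvd_lcm_left a b)] at ha
    rw [coe_mem_cyclo_iff (Nat.dvd_lcm_right a b)] at hb
    have htc := coprime_of_algEquiv_cycloRoot hσ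
    -- `σ = τ * (τ⁻¹ * σ)` where `τ` fixes `ℚ_a` and `τ⁻¹ * σ` fixes `ℚ_b`
    obtain ⟨r, hra, hrb⟩ := Nat.chineseRemainder' (n := a) (m := b) ht.symm
    have hrc : r.Coprime (a.lcm b) := by
      have h1 : r.Coprime a := by rw [Nat.Coprime, hra.gcd_eq, Nat.gcd_one_left]
      have h2 : r.Coprime b := by
        rw [Nat.Coprime, hrb.gcd_eq]
        exact htc.coprime_dvd_right (Nat.dvd_lcm_right a b)
      exact (h1.mul_right h2).coprime_dvd_right (Nat.lcm_dvd_mul a b)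
    obtain ⟨τ, hτ⟩ := exists_algEquiv_cycloRoot (a.lcm b) r hrc
    obtain ⟨s, -, hs⟩ := exists_pow_cycloRoot (a.lcm b) (σ.trans τ.symm)
    change τ.symm (σ _) = _ at hs
    have hrs : r * s ≡ t [MOD a.lcm b] := by
      have h1 : σ (cycloRoot (a.lcm b)) = τ (cycloRoot (a.lcm b) ^ s) := by
        rw [← hs, AlgEquiv.apply_symm_apply]
      rw [hσ, map_pow, hτ, ← pow_mul,
        isPrimitiveRoot_pow_eq_pow_iff (isPrimitiveRoot_cycloRoot _)] at h1
      exact h1.symm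
    have hsb : s ≡ 1 [MOD b] := by
      have h1 : t * s ≡ t * 1 [MOD b] := by
        rw [mul_one]
        exact (hrb.symm.mul_right s).trans (hrs.of_dvd (Nat.dvd_lcm_right a b))
      exact h1.cancel_left_of_coprime
        (Nat.coprime_comm.mp (htc.coprime_dvd_right (Nat.dvd_lcm_right a b)))
    have h1 : τ.symm (σ y) = y := hb (σ.trans τ.symm) s hs hsb
    rw [← AlgEquiv.apply_symm_apply τ (σ y), h1, ha τ r hτ hra]
  exact key ⟨x, hx⟩ hxa hxb

/-! ### Conductors -/

theorem fieldConductor_spec {K : IntermediateField ℚ ℂ} {n : ℕ} (hn : n ≠ 0) (hK : K ≤ cyclo n) :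
    0 < fieldConductor K ∧ K ≤ cyclo (fieldConductor K) :=
  Nat.sInf_mem (s := {n : ℕ | 0 < n ∧ K ≤ cyclo n}) ⟨n, Nat.pos_of_ne_zero hn, hK⟩

/-- An abelian number field lies in `ℚ_n` exactly when its conductor divides `n`. -/
theorem fieldConductor_dvd_iff {K : IntermediateField ℚ ℂ} {n b : ℕ} (hn : n ≠ 0)
    (hK : K ≤ cyclo n) (hb : b ≠ 0) : fieldConductor K ∣ b ↔ K ≤ cyclo b := by
  obtain ⟨hc, hKc⟩ := fieldConductor_spec hn hK
  have : NeZero b := ⟨hb⟩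
  have : NeZero (fieldConductor K) := ⟨hc.ne'⟩
  refine ⟨fun h => hKc.trans (cyclo_mono h), fun h => ?_⟩
  have h1 : fieldConductor K ≤ (fieldConductor K).gcd b :=
    Nat.sInf_le ⟨Nat.gcd_pos_of_pos_left b hc, (le_inf hKc h).trans (cyclo_inf_le _ b)⟩
  exact Nat.gcd_eq_left_iff_dvd.mp (le_antisymm (Nat.gcd_le_left b hc) h1)

theorem isPRational_iff {p m a : ℕ} (hp : p.Prime) (hm : ¬ p ∣ m) {G : Type*} {χ : G → ℂ}
    (h : valueField χ ≤ cyclo (p ^ a * m)) : IsPRational p χ ↔ valueField χ ≤ cyclo m := by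
  have hm0 : m ≠ 0 := fun h0 => hm (h0 ▸ dvd_zero p)
  have hn : p ^ a * m ≠ 0 := mul_ne_zero (pow_ne_zero a hp.ne_zero) hm0
  have hc := (fieldConductor_spec hn h).1
  rw [← fieldConductor_dvd_iff hn h hm0, IsPRational, rationalityLevel,
    Nat.factorization_eq_zero_iff]
  have hdvd := (fieldConductor_dvd_iff hn h hn).mpr h
  constructor
  · intro h1
    have h2 : ¬ p ∣ fieldConductor (valueField χ) := by
      rcases h1 with h1 | h1 | h1
      · exact absurd hp h1
      · exact h1
      · omega
    exact Nat.Coprime.dvd_of_dvd_mul_left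
      (Nat.Coprime.pow_right a ((Nat.Prime.coprime_iff_not_dvd hp).mpr h2).symm) hdvd
  · exact fun h1 => Or.inr (Or.inl fun h2 => hm (h2.trans h1))

theorem isAlmostPRational_iff {p m a : ℕ} (hp : p.Prime) (hm : ¬ p ∣ m) {G : Type*} {χ : G → ℂ}
    (h : valueField χ ≤ cyclo (p ^ a * m)) :
    IsAlmostPRational p χ ↔ valueField χ ≤ cyclo (p * m) := by
  have hm0 : m ≠ 0 := fun h0 => hm (h0 ▸ dvd_zero p)
  have hn : p ^ a * m ≠ 0 := mul_ne_zero (pow_ne_zero a hp.ne_zero) hm0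
  have hc := (fieldConductor_spec hn h).1
  rw [← fieldConductor_dvd_iff hn h (mul_ne_zero hp.ne_zero hm0), IsAlmostPRational,
    rationalityLevel]
  have hdvd := (fieldConductor_dvd_iff hn h hn).mpr h
  generalize fieldConductor (valueField χ) = c at *
  have hc' : c = p ^ c.factorization p * (c / p ^ c.factorization p) :=
    (Nat.ordProj_mul_ordCompl_eq_self c p).symm
  have hcop : Nat.Coprime p (c / p ^ c.factorization p) := Nat.coprime_ordCompl hp hc.ne'
  constructor
  · intro h1
    rw [hc']
    refine mul_dvd_mul ?_ ?_
    · conv_rhs => rw [← pow_one p]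
      exact pow_dvd_pow p h1
    · exact Nat.Coprime.dvd_of_dvd_mul_left (Nat.Coprime.pow_right a hcop.symm)
        ((Nat.ordCompl_dvd c p).trans hdvd)
  · intro h1
    by_contra h2
    have h3 : p * p ∣ p * m := by
      rw [← sq]
      exact ((pow_dvd_pow p (by omega)).trans (Nat.ordProj_dvd c p)).trans h1
    exact hm (Nat.dvd_of_mul_dvd_mul_left hp.pos h3)

theorem cyclo_two_mul_le {m : ℕ} (hm : Odd m) : cyclo (2 * m) ≤ cyclo m := by
  have : NeZero m := ⟨hm.pos.ne'⟩
  rw [cyclo, IntermediateField.adjoin_simple_le_iff]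
  have h := (Complex.isPrimitiveRoot_exp (2 * m) (by simp [NeZero.ne m])).pow_eq_one
  generalize Complex.exp (2 * Real.pi * Complex.I / (2 * m : ℕ)) = z at h
  rw [mul_comm, pow_mul, sq, mul_self_eq_one_iff] at h
  rcases h with h | h
  · exact mem_cyclo_of_pow_eq_one h
  · rw [← neg_neg z]
    exact neg_mem (mem_cyclo_of_pow_eq_one (by rw [hm.neg_pow, h, neg_neg]))

/-- Since `ℚ_{2m} = ℚ_m` for odd `m`, no conductor is congruent to `2` modulo `4`. -/
theorem isPRational_two_of_isAlmostPRational {G : Type*} {χ : G → ℂ} {n : ℕ} (hn : n ≠ 0)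
    (h : valueField χ ≤ cyclo n) (hχ : IsAlmostPRational 2 χ) : IsPRational 2 χ := by
  obtain ⟨a, m, hm, rfl⟩ := Nat.exists_eq_two_pow_mul_odd hn
  have hm' : ¬ 2 ∣ m := fun h2 => (Nat.not_even_iff_odd.mpr hm) (even_iff_two_dvd.mpr h2)
  rw [isAlmostPRational_iff Nat.prime_two hm' h] at hχ
  rw [isPRational_iff Nat.prime_two hm' h]
  exact hχ.trans (cyclo_two_mul_le hm)

/-! ### Values of characters and the Galois action -/

section Trace

variable {V : Type*} [AddCommGroup V] [Module ℂ V] [FiniteDimensional ℂ V]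

/-- The average of the powers of an endomorphism `h` with `h ^ n = 1` is a projection. -/
theorem exists_trace_average_eq_natCast {n : ℕ} (hn : n ≠ 0) {h : Module.End ℂ V} (hh : h ^ n = 1) :
    ∃ m : ℕ, (n : ℂ)⁻¹ * ∑ s ∈ Finset.range n, LinearMap.trace ℂ V (h ^ s) = m := by
  set e : Module.End ℂ V := (n : ℂ)⁻¹ • ∑ s ∈ Finset.range n, h ^ s with he
  have h1 : h * e = e := by
    have h2 : (h - 1) * ∑ s ∈ Finset.range n, h ^ s = 0 := by rw [mul_geom_sum, hh, sub_self]
    rw [sub_mul, one_mul, sub_eq_zero] at h2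
    rw [he, mul_smul_comm, h2]
  have h2 : ∀ s : ℕ, h ^ s * e = e := by
    intro s
    induction s with
    | zero => rw [pow_zero, one_mul]
    | succ s ih => rw [pow_succ, mul_assoc, h1, ih]
  have h3 : IsIdempotentElem e := by
    rw [IsIdempotentElem]
    conv_lhs => lhs; rw [he]
    rw [smul_mul_assoc, Finset.sum_mul, Finset.sum_congr rfl fun s _ => h2 s, Finset.sum_const,
      Finset.card_range, ← Nat.cast_smul_eq_nsmul ℂ, smul_smul, inv_mul_cancel₀ (by simpa),
      one_smul]
  refine ⟨Module.finrank ℂ (LinearMap.range e), ?_⟩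
  rw [← ((LinearMap.isProj_range_iff_isIdempotentElem e).mpr h3).trace, he, map_smul, map_sum,
    smul_eq_mul]

/-- The traces of the powers of an endomorphism of finite order `n` are combinations of powers of
`n`-th roots of unity with multiplicities that do not depend on the exponent. -/
theorem exists_trace_pow_eq_sum {n : ℕ} (hn : n ≠ 0) {f : Module.End ℂ V} (hf : f ^ n = 1) {ζ : ℂ}
    (hζ : IsPrimitiveRoot ζ n) :
    ∃ m : ℕ → ℕ, ∀ t : ℕ,
      LinearMap.trace ℂ V (f ^ t) = ∑ i ∈ Finset.range n, (m i : ℂ) * (ζ ^ i) ^ t := by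
  have h0 : ∀ i : ℕ, ((ζ ^ i)⁻¹ • f) ^ n = 1 := by
    intro i
    rw [smul_pow, hf, inv_pow, ← pow_mul, mul_comm, pow_mul, hζ.pow_eq_one, one_pow, inv_one,
      one_smul]
  choose m hm using fun i => exists_trace_average_eq_natCast hn (h0 i)
  refine ⟨m, fun t => ?_⟩
  have hζ0 : ζ ≠ 0 := hζ.ne_zero hn
  have hgeom : ∀ s ∈ Finset.range n, ∑ i ∈ Finset.range n, (ζ ^ t * (ζ ^ s)⁻¹) ^ i =
      if s = t % n then (n : ℂ) else 0 := by
    intro s hs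
    have hs' := Finset.mem_range.mp hs
    have hiff : ζ ^ t * (ζ ^ s)⁻¹ = 1 ↔ s = t % n := by
      have : NeZero n := ⟨hn⟩
      rw [mul_inv_eq_one₀ (pow_ne_zero s hζ0), isPrimitiveRoot_pow_eq_pow_iff hζ, Nat.ModEq,
        Nat.mod_eq_of_lt hs', eq_comm]
    split_ifs with h
    · rw [hiff.mpr h]
      simp
    · have h1 : (ζ ^ t * (ζ ^ s)⁻¹ - 1) * ∑ i ∈ Finset.range n, (ζ ^ t * (ζ ^ s)⁻¹) ^ i = 0 := by
        rw [mul_geom_sum, mul_pow, inv_pow, ← pow_mul, ← pow_mul, mul_comm t, mul_comm s, pow_mul,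
          pow_mul, hζ.pow_eq_one, one_pow, one_pow, inv_one, mul_one, sub_self]
      exact (mul_eq_zero.mp h1).resolve_left (sub_ne_zero.mpr (mt hiff.mp h))
  have hmod : f ^ t = f ^ (t % n) := by
    conv_lhs => rw [← Nat.mod_add_div t n, pow_add, pow_mul, hf, one_pow, mul_one]
  symm
  calc ∑ i ∈ Finset.range n, (m i : ℂ) * (ζ ^ i) ^ t
      = ∑ i ∈ Finset.range n, ∑ s ∈ Finset.range n,
          (n : ℂ)⁻¹ * ((ζ ^ t * (ζ ^ s)⁻¹) ^ i * LinearMap.trace ℂ V (f ^ s)) := by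
        refine Finset.sum_congr rfl fun i _ => ?_
        rw [← hm i, Finset.mul_sum, Finset.sum_mul]
        refine Finset.sum_congr rfl fun s _ => ?_
        rw [smul_pow, map_smul, smul_eq_mul, mul_pow, inv_pow, inv_pow, ← pow_mul, ← pow_mul,
          ← pow_mul, ← pow_mul, mul_comm t i, mul_comm s i]
        ring
    _ = ∑ s ∈ Finset.range n, if s = t % n then LinearMap.trace ℂ V (f ^ s) else 0 := by
        rw [Finset.sum_comm]
        refine Finset.sum_congr rfl fun s hs => ?_
        rw [← Finset.mul_sum, ← Finset.sum_mul, hgeom s hs]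
        split_ifs with h
        · rw [← mul_assoc, inv_mul_cancel₀ (by simpa), one_mul]
        · simp
    _ = LinearMap.trace ℂ V (f ^ t) := by
        rw [Finset.sum_ite_eq',
          if_pos (Finset.mem_range.mpr (Nat.mod_lt t (Nat.pos_of_ne_zero hn))), hmod]

/-- The trace of an endomorphism all of whose eigenvalues are roots of unity or zero is an algebraic
integer. -/
theorem isIntegral_trace_of_pow_eq {n : ℕ} {f : Module.End ℂ V}
    (hf : f ^ (n + 3) = f ^ 2) : IsIntegral ℤ (LinearMap.trace ℂ V f) := by
  rw [Module.End.trace_eq_sum_roots_charpoly_of_splits (IsAlgClosed.splits _)]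
  refine IsIntegral.multiset_sum fun α hα => ?_
  have h1 : f.HasEigenvalue α := by
    rw [Module.End.hasEigenvalue_iff_isRoot_charpoly]
    exact Polynomial.isRoot_of_mem_roots hα
  obtain ⟨v, hv⟩ := h1.exists_hasEigenvector
  have h2 : α ^ (n + 3) = α ^ 2 := by
    have h3 := hv.pow_apply (n + 3)
    rw [hf, hv.pow_apply 2] at h3
    exact (smul_left_injective ℂ hv.2 h3).symm
  refine ⟨Polynomial.X ^ (n + 3) - Polynomial.X ^ 2, ?_, by simp [h2]⟩
  apply Polynomial.monic_X_pow_sub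
  rw [Polynomial.degree_X_pow]
  exact_mod_cast (by omega : 2 < n + 3)

end Trace

section Galois

theorem character_pow_pow {H : Type*} [Group H] {V : Type*} [AddCommGroup V] [Module ℂ V]
    (ρ : Representation ℂ H V) {k : ℕ} (hk : ∀ g, ρ.character (g ^ k) = ρ.character g) (i : ℕ)
    (g : H) : ρ.character (g ^ k ^ i) = ρ.character g := by
  induction i with
  | zero => rw [pow_zero, pow_one]
  | succ i ih => rw [pow_succ, pow_mul, hk, ih]

variable {H : Type*} [Group H] {V : Type*} [AddCommGroup V] [Module ℂ V] [FiniteDimensional ℂ V]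
  (ρ : Representation ℂ H V) {n : ℕ} [NeZero n]

/-- Character values lie in `ℚ_n`, and an automorphism of `ℚ_n` acting as `ζ ↦ ζ ^ t` sends the
value `χ g` to `χ (g ^ t)`. -/
theorem exists_coe_eq_character (hH : ∀ g : H, g ^ n = 1) (g : H) :
    ∃ x : cyclo n, (x : ℂ) = ρ.character g ∧ ∀ (σ : cyclo n ≃ₐ[ℚ] cyclo n) (t : ℕ),
      σ (cycloRoot n) = cycloRoot n ^ t → ((σ x : cyclo n) : ℂ) = ρ.character (g ^ t) := by
  have hf : (ρ g) ^ n = 1 := by rw [← map_pow, hH, map_one]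
  obtain ⟨m, hm⟩ := exists_trace_pow_eq_sum (NeZero.ne n) hf
    (Complex.isPrimitiveRoot_exp n (NeZero.ne n))
  have hval : ∀ t : ℕ, ((∑ i ∈ Finset.range n, (m i : cyclo n) * (cycloRoot n ^ i) ^ t : cyclo n) :
      ℂ) = ρ.character (g ^ t) := by
    intro t
    rw [Representation.character, map_pow, hm t]
    change (cyclo n).val _ = _
    simp only [map_sum, map_mul, map_natCast, map_pow]
    rfl
  refine ⟨∑ i ∈ Finset.range n, (m i : cyclo n) * (cycloRoot n ^ i) ^ 1, ?_, ?_⟩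
  · rw [hval, pow_one]
  · intro σ t hσ
    rw [← hval t]
    congr 1
    simp only [map_sum, map_mul, map_natCast, map_pow, hσ, pow_one]
    refine Finset.sum_congr rfl fun i _ => ?_
    rw [← pow_mul, ← pow_mul, mul_comm t i]

theorem valueField_character_le_cyclo_iff (hH : ∀ g : H, g ^ n = 1) {d : ℕ} (hd : d ∣ n) :
    valueField ρ.character ≤ cyclo d ↔
      ∀ t : ℕ, t.Coprime n → t ≡ 1 [MOD d] → ∀ g, ρ.character (g ^ t) = ρ.character g := by
  rw [valueField, IntermediateField.adjoin_le_iff, Set.range_subset_iff]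
  constructor
  · intro h t htn htd g
    obtain ⟨σ, hσ⟩ := exists_algEquiv_cycloRoot n t htn
    obtain ⟨x, hx, hσx⟩ := exists_coe_eq_character ρ hH g
    rw [← hσx σ t hσ, ← hx]
    have h1 : (x : ℂ) ∈ cyclo d := hx ▸ h g
    rw [(coe_mem_cyclo_iff hd x).mp h1 σ t hσ htd]
  · intro h g
    obtain ⟨x, hx, hσx⟩ := exists_coe_eq_character ρ hH g
    rw [SetLike.mem_coe, ← hx, coe_mem_cyclo_iff hd]
    intro σ t hσ htd
    apply Subtype.ext
    rw [hσx σ t hσ, hx, h t (coprime_of_algEquiv_cycloRoot hσ) htd]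

theorem valueField_character_le_cyclo (hH : ∀ g : H, g ^ n = 1) :
    valueField ρ.character ≤ cyclo n := by
  rw [valueField, IntermediateField.adjoin_le_iff, Set.range_subset_iff]
  intro g
  obtain ⟨x, hx, -⟩ := exists_coe_eq_character ρ hH g
  exact hx ▸ x.2

theorem isGaloisInvariant_character_iff (hH : ∀ g : H, g ^ n = 1) {σ : cyclo n ≃ₐ[ℚ] cyclo n}
    {t : ℕ} (hσ : σ (cycloRoot n) = cycloRoot n ^ t) :
    IsGaloisInvariant σ ρ.character ↔ ∀ g, ρ.character (g ^ t) = ρ.character g := by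
  refine forall_congr' fun g => ?_
  obtain ⟨x, hx, hσx⟩ := exists_coe_eq_character ρ hH g
  rw [← hσx σ t hσ, ← hx]
  constructor
  · rintro ⟨y, hy, hσy⟩
    rw [← Subtype.ext hy, hσy]
  · exact fun h => ⟨x, rfl, Subtype.ext h⟩

/-- If the powers of `k` exhaust the classes modulo `n` that are `1` modulo `d`, then a single
automorphism decides whether the values of a character lie in `ℚ_d`. -/
theorem isGaloisInvariant_character_iff_valueField_le (hH : ∀ g : H, g ^ n = 1) {d k : ℕ}
    (hd : d ∣ n) (hkd : k ≡ 1 [MOD d])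
    (hgen : ∀ t : ℕ, t.Coprime n → t ≡ 1 [MOD d] → ∃ i, k ^ i ≡ t [MOD n])
    {σ : cyclo n ≃ₐ[ℚ] cyclo n} (hσ : σ (cycloRoot n) = cycloRoot n ^ k) :
    IsGaloisInvariant σ ρ.character ↔ valueField ρ.character ≤ cyclo d := by
  rw [isGaloisInvariant_character_iff ρ hH hσ, valueField_character_le_cyclo_iff ρ hH hd]
  refine ⟨fun h t htn htd g => ?_, fun h => h k (coprime_of_algEquiv_cycloRoot hσ) hkd⟩
  obtain ⟨i, hi⟩ := hgen t htn htd
  have h1 : g ^ t = g ^ k ^ i :=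
    pow_eq_pow_iff_modEq.mpr (hi.symm.of_dvd (orderOf_dvd_of_pow_eq_one (hH g)))
  rw [h1, character_pow_pow ρ h]

end Galois

theorem actsAsFrobeniusPow_zero {p m a t : ℕ} (hp : p.Prime) (hm : ¬ p ∣ m) {n : ℕ} [NeZero n]
    (hn : n = p ^ a * m) {σ : cyclo n ≃ₐ[ℚ] cyclo n} (hσ : σ (cycloRoot n) = cycloRoot n ^ t)
    (ht : t ≡ 1 [MOD m]) : ActsAsFrobeniusPow p 0 σ := by
  subst hn
  intro k ξ hk hξ
  have : NeZero k := ⟨fun h0 => hk (h0 ▸ dvd_zero p)⟩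
  have : NeZero m := ⟨fun h0 => hm (h0 ▸ dvd_zero p)⟩
  rw [pow_zero, pow_one]
  refine (coe_mem_cyclo_iff (dvd_mul_left m _) ξ).mp ?_ σ t hσ ht
  have h1 : (ξ : ℂ) ∈ cyclo k := mem_cyclo_of_pow_eq_one (by exact_mod_cast hξ)
  refine cyclo_mono ?_ (cyclo_inf_le k (p ^ a * m) ⟨h1, ξ.2⟩)
  exact Nat.Coprime.dvd_of_dvd_mul_left (Nat.Coprime.pow_right a
    ((Nat.Prime.coprime_iff_not_dvd hp).mpr fun h => hk (h.trans (Nat.gcd_dvd_left k _))).symm)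
    (Nat.gcd_dvd_right k _)

/-! ### Irreducible representations of finite groups -/

section Irreducible

open Representation

variable {H : Type*} [Group H] {V : Type*} [AddCommGroup V] [Module ℂ V]

theorem isIrreducible_iff (ρ : Representation ℂ H V) :
    ρ.IsIrreducible ↔ Nontrivial V ∧ ∀ W : Submodule ℂ V, (∀ g, ∀ v ∈ W, ρ g v ∈ W) →
      W = ⊥ ∨ W = ⊤ := by
  constructor
  · intro h
    refine ⟨?_, fun W hW => ?_⟩
    · by_contra hV
      rw [not_nontrivial_iff_subsingleton] at hV
      exact bot_ne_top (α := Subrepresentation ρ)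
        (Subrepresentation.toSubmodule_injective (Subsingleton.elim _ _))
    · rcases eq_bot_or_eq_top (⟨W, fun g v hv => hW g v hv⟩ : Subrepresentation ρ) with h1 | h1
      · exact Or.inl (congrArg Subrepresentation.toSubmodule h1)
      · exact Or.inr (congrArg Subrepresentation.toSubmodule h1)
  · rintro ⟨hV, h⟩
    refine { exists_pair_ne := ⟨⊥, ⊤, fun h1 => ?_⟩, eq_bot_or_eq_top := fun W => ?_ }
    · exact bot_ne_top (α := Submodule ℂ V) (congrArg Subrepresentation.toSubmodule h1)
    · rcases h W.toSubmodule (fun g v hv => W.apply_mem_toSubmodule g hv) with h1 | h1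
      · exact Or.inl (Subrepresentation.toSubmodule_injective h1)
      · exact Or.inr (Subrepresentation.toSubmodule_injective h1)

theorem coe_toRepresentation_apply {ρ : Representation ℂ H V} (W : Subrepresentation ρ) (g : H)
    (w : W.toSubmodule) : (W.toRepresentation g w : V) = ρ g w := rfl

/-- Schur's lemma for a single endomorphism. -/
theorem exists_eq_smul_one [FiniteDimensional ℂ V] (ρ : Representation ℂ H V)
    (hρ : ρ.IsIrreducible) (z : Module.End ℂ V) (hz : ∀ g, z * ρ g = ρ g * z) :
    ∃ c : ℂ, z = c • 1 := by
  obtain ⟨hV, h⟩ := (isIrreducible_iff ρ).mp hρ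
  obtain ⟨c, hc⟩ := Module.End.exists_eigenvalue z
  have hinv : ∀ g, ∀ v ∈ z.eigenspace c, ρ g v ∈ z.eigenspace c := by
    intro g v hv
    rw [Module.End.mem_eigenspace_iff] at hv ⊢
    have := LinearMap.congr_fun (hz g) v
    rw [Module.End.mul_apply, Module.End.mul_apply, hv, map_smul] at this
    exact this
  refine ⟨c, ?_⟩
  rcases h (z.eigenspace c) hinv with h1 | h1
  · exact absurd h1 hc
  · ext v
    have : v ∈ z.eigenspace c := h1 ▸ Submodule.mem_top
    simpa using Module.End.mem_eigenspace_iff.mp this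

theorem exists_isIrreducible_subrepresentation [FiniteDimensional ℂ V] [Nontrivial V]
    (ρ : Representation ℂ H V) : ∃ W : Subrepresentation ρ, W.toRepresentation.IsIrreducible := by
  have hne : {d : ℕ | ∃ W : Subrepresentation ρ, W.toSubmodule ≠ ⊥ ∧
      Module.finrank ℂ W.toSubmodule = d}.Nonempty := ⟨_, ⊤, top_ne_bot, rfl⟩
  obtain ⟨W, hW, hd⟩ := Nat.sInf_mem hne
  refine ⟨W, (isIrreducible_iff _).mpr ⟨Submodule.nontrivial_iff_ne_bot.mpr hW, fun U hU => ?_⟩⟩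
  by_contra hcon
  rw [not_or] at hcon
  have hmap : U.map W.toSubmodule.subtype ≠ ⊥ := fun h0 =>
    hcon.1 (Submodule.map_injective_of_injective W.toSubmodule.subtype_injective
      (h0.trans (Submodule.map_bot _).symm))
  have h1 : sInf {d : ℕ | ∃ W : Subrepresentation ρ, W.toSubmodule ≠ ⊥ ∧
      Module.finrank ℂ W.toSubmodule = d} ≤ Module.finrank ℂ (U.map W.toSubmodule.subtype) := by
    refine Nat.sInf_le ⟨⟨U.map W.toSubmodule.subtype, ?_⟩, hmap, rfl⟩
    rintro g _ ⟨w, hw, rfl⟩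
    exact ⟨W.toRepresentation g w, hU g w hw, rfl⟩
  rw [← hd, Submodule.finrank_map_subtype_eq] at h1
  exact absurd (Submodule.finrank_lt hcon.2) (not_lt.mpr h1)

theorem isSemisimpleRepresentation [Finite H] (ρ : Representation ℂ H V) :
    ρ.IsSemisimpleRepresentation := by
  have : NeZero (Nat.card H : ℂ) := ⟨Nat.cast_ne_zero.mpr Nat.card_pos.ne'⟩
  rw [isSemisimpleRepresentation_iff_isSemisimpleModule_asModule]
  infer_instance

theorem exists_isCompl_subrepresentation [Finite H] {ρ : Representation ℂ H V}
    (W : Subrepresentation ρ) : ∃ U : Subrepresentation ρ, IsCompl W.toSubmodule U.toSubmodule := by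
  have := isSemisimpleRepresentation ρ
  obtain ⟨U, hU⟩ := exists_isCompl W
  refine ⟨U, ⟨disjoint_iff.mpr ?_, codisjoint_iff.mpr ?_⟩⟩
  · exact congrArg Subrepresentation.toSubmodule hU.inf_eq_bot
  · exact congrArg Subrepresentation.toSubmodule hU.sup_eq_top

theorem isIrreducible_conj {V' : Type*} [AddCommGroup V'] [Module ℂ V'] {ρ : Representation ℂ H V}
    (hρ : ρ.IsIrreducible) (ρ' : Representation ℂ H V') (e : V ≃ₗ[ℂ] V')
    (he : ∀ g v, ρ' g (e v) = e (ρ g v)) : ρ'.IsIrreducible := by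
  obtain ⟨hV, h⟩ := (isIrreducible_iff ρ).mp hρ
  refine (isIrreducible_iff ρ').mpr ⟨e.symm.toEquiv.nontrivial, fun W hW => ?_⟩
  have h1 : W = (W.comap e.toLinearMap).map e.toLinearMap :=
    (Submodule.map_comap_eq_of_surjective e.surjective W).symm
  have hinv : ∀ g, ∀ v ∈ W.comap e.toLinearMap, ρ g v ∈ W.comap e.toLinearMap := by
    intro g v hv
    have := hW g _ hv
    change ρ' g (e v) ∈ W at this
    rw [he] at this
    exact this
  rcases h (W.comap e.toLinearMap) hinv with h2 | h2
  · rw [h2, Submodule.map_bot] at h1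
    exact Or.inl h1
  · rw [h2, Submodule.map_top, LinearEquiv.range] at h1
    exact Or.inr h1

theorem character_mem_Irr [FiniteDimensional ℂ V] {ρ : Representation ℂ H V}
    (hρ : ρ.IsIrreducible) : ρ.character ∈ Irr H := by
  let e : V ≃ₗ[ℂ] (Fin (Module.finrank ℂ V) → ℂ) := (Module.finBasis ℂ V).equivFun
  let ρ' : Representation ℂ H (Fin (Module.finrank ℂ V) → ℂ) :=
    { toFun := fun g => e.conj (ρ g)
      map_one' := by rw [map_one]; exact LinearEquiv.conj_id e
      map_mul' := fun g h => by rw [map_mul]; exact LinearEquiv.conj_comp e _ _ }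
  have he : ∀ g v, ρ' g (e v) = e (ρ g v) := by
    intro g v
    change e (ρ g (e.symm (e v))) = _
    rw [LinearEquiv.symm_apply_apply]
  refine ⟨_, ρ', isIrreducible_conj hρ ρ' e he, ?_⟩
  ext g
  exact LinearMap.trace_conj' (ρ g) e

/-- Distinct irreducible characters are linearly independent, so there are finitely many. -/
theorem finite_Irr [Finite H] : (Irr H).Finite := by
  classical
  have := Fintype.ofFinite H
  have hcard : (Nat.card H : ℂ) ≠ 0 := Nat.cast_ne_zero.mpr Nat.card_pos.ne'
  have : Invertible (Nat.card H : ℂ) := invertibleOfNonzero hcard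
  have horth : ∀ χ ψ : Irr H,
      (Nat.card H : ℂ)⁻¹ * ∑ g : H, (χ : H → ℂ) g * (ψ : H → ℂ) g⁻¹ = if χ = ψ then 1 else 0 := by
    rintro ⟨_, d, ρ, hρ, rfl⟩ ⟨_, e, τ, hτ, rfl⟩
    rw [char_orthonormal ρ τ]
    split_ifs with h1 h2 h2
    · rfl
    · obtain ⟨φ⟩ := h1
      exact absurd (Subtype.ext (char_iso φ.symm)) h2
    · -- equal characters have inner product `1`
      have h3 := char_orthonormal ρ τ
      have h4 := char_orthonormal ρ ρ
      rw [if_neg h1] at h3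
      rw [if_pos ⟨Representation.Equiv.refl ρ⟩] at h4
      have h5 : ρ.character = τ.character := congrArg Subtype.val h2
      rw [← h5, h4] at h3
      exact h3.symm
    · rfl
  have hli : LinearIndependent ℂ (fun χ : Irr H => (χ : H → ℂ)) := by
    rw [linearIndependent_iff']
    intro s c hc ψ hψ
    have h1 : ∑ χ ∈ s, c χ * ((Nat.card H : ℂ)⁻¹ * ∑ g : H, (χ : H → ℂ) g * (ψ : H → ℂ) g⁻¹) =
        (Nat.card H : ℂ)⁻¹ * ∑ g : H, (∑ χ ∈ s, c χ • (χ : H → ℂ)) g * (ψ : H → ℂ) g⁻¹ := by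
      simp only [Finset.sum_apply, Pi.smul_apply, smul_eq_mul, Finset.sum_mul, Finset.mul_sum]
      rw [Finset.sum_comm]
      refine Finset.sum_congr rfl fun g _ => Finset.sum_congr rfl fun χ _ => ?_
      ring
    rw [hc] at h1
    simp only [horth, mul_ite, mul_one, mul_zero, Finset.sum_ite_eq', hψ, if_true, Pi.zero_apply,
      zero_mul, Finset.sum_const_zero] at h1
    exact h1
  have := hli.finite
  exact Set.toFinite _

theorem sum_conj_mul_comm [Fintype H] (ρ : Representation ℂ H V) (a y : H) :
    (∑ x : H, ρ (x * a * x⁻¹)) * ρ y = ρ y * ∑ x : H, ρ (x * a * x⁻¹) := by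
  rw [Finset.sum_mul, Finset.mul_sum]
  refine (Fintype.sum_equiv (Equiv.mulLeft y) _ _ fun x => ?_).symm
  rw [← map_mul, ← map_mul, Equiv.coe_mulLeft]
  congr 1
  group

/-- The sum of the conjugates of `g` acts on an irreducible representation as a scalar determined by
the character value at `g`. -/
theorem sum_conj_eq_of_character_eq [Fintype H] [FiniteDimensional ℂ V] {ρ : Representation ℂ H V}
    (hρ : ρ.IsIrreducible) {g h : H} (hgh : ρ.character g = ρ.character h) :
    ∑ x : H, ρ (x * g * x⁻¹) = ∑ x : H, ρ (x * h * x⁻¹) := by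
  have hV : Nontrivial V := ((isIrreducible_iff ρ).mp hρ).1
  have htr : ∀ a : H, LinearMap.trace ℂ V (∑ x : H, ρ (x * a * x⁻¹)) =
      Fintype.card H * ρ.character a := by
    intro a
    rw [map_sum]
    change ∑ x : H, ρ.character (x * a * x⁻¹) = _
    rw [Finset.sum_congr rfl fun x _ => char_conj ρ a x, Finset.sum_const, Finset.card_univ,
      nsmul_eq_mul]
  obtain ⟨c, hc⟩ := exists_eq_smul_one ρ hρ (∑ x : H, ρ (x * g * x⁻¹)) (sum_conj_mul_comm ρ g)
  obtain ⟨d, hd⟩ := exists_eq_smul_one ρ hρ (∑ x : H, ρ (x * h * x⁻¹)) (sum_conj_mul_comm ρ h)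
  have h1 : LinearMap.trace ℂ V (c • 1) = LinearMap.trace ℂ V (d • 1) := by
    rw [← hc, ← hd, htr, htr, hgh]
  rw [map_smul, map_smul, LinearMap.trace_one, smul_eq_mul, smul_eq_mul] at h1
  have h2 : (Module.finrank ℂ V : ℂ) ≠ 0 := Nat.cast_ne_zero.mpr Module.finrank_pos.ne'
  rw [hc, hd, mul_right_cancel₀ h2 h1]

/-- The left regular representation, on the functions on `H`. -/
def leftTranslation (H : Type*) [Group H] : Representation ℂ H (H → ℂ) where
  toFun g := LinearMap.funLeft ℂ ℂ fun x => g⁻¹ * x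
  map_one' := by ext; simp [LinearMap.funLeft_apply]
  map_mul' g h := by
    ext f x
    simp [LinearMap.funLeft_apply, mul_assoc]

theorem leftTranslation_apply (g x : H) (f : H → ℂ) : leftTranslation H g f x = f (g⁻¹ * x) := rfl

/-- Irreducible characters separate conjugacy classes. -/
theorem isConj_of_forall_Irr [Finite H] {g h : H} (hgh : ∀ χ ∈ Irr H, χ g = χ h) :
    IsConj g h := by
  classical
  have := Fintype.ofFinite H
  set ρ : Representation ℂ H (H → ℂ) := leftTranslation H with hρ
  set z : Module.End ℂ (H → ℂ) := ∑ x : H, ρ (x * g * x⁻¹) - ∑ x : H, ρ (x * h * x⁻¹) with hz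
  have hzc : ∀ y, z * ρ y = ρ y * z := fun y => by
    rw [hz, _root_.sub_mul, _root_.mul_sub, sum_conj_mul_comm, sum_conj_mul_comm]
  -- `z` kills every irreducible subrepresentation of the regular representation
  let N : Subrepresentation ρ := ⟨LinearMap.ker z, fun y v hv => by
    rw [LinearMap.mem_ker] at hv ⊢
    rw [← Module.End.mul_apply, hzc, Module.End.mul_apply, hv, map_zero]⟩
  have hz0 : z = 0 := by
    obtain ⟨C, hC⟩ := exists_isCompl_subrepresentation N
    have hCbot : C.toSubmodule = ⊥ := by
      by_contra hne
      have : Nontrivial C.toSubmodule := Submodule.nontrivial_iff_ne_bot.mpr hne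
      obtain ⟨W, hW⟩ := exists_isIrreducible_subrepresentation (V := C.toSubmodule)
        C.toRepresentation
      have h1 := sum_conj_eq_of_character_eq hW (hgh _ (character_mem_Irr hW))
      obtain ⟨w, hw⟩ := @exists_ne _ ((isIrreducible_iff _).mp hW).1 (0 : W.toSubmodule)
      have h2 := congrArg (fun f => (((f w : W.toSubmodule) : C.toSubmodule) : H → ℂ)) h1
      simp only [LinearMap.sum_apply, AddSubmonoidClass.coe_finsetSum,
        coe_toRepresentation_apply] at h2
      have h3 : ((w : C.toSubmodule) : H → ℂ) ∈ N.toSubmodule := by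
        change _ ∈ LinearMap.ker z
        rw [LinearMap.mem_ker, hz, LinearMap.sub_apply, LinearMap.sum_apply, LinearMap.sum_apply,
          h2, sub_self]
      have h4 := (Submodule.disjoint_def.mp hC.disjoint) _ h3 (w : C.toSubmodule).2
      exact hw (Subtype.ext (Subtype.ext h4))
    have htop : N.toSubmodule = ⊤ := by
      have := hC.sup_eq_top
      rwa [hCbot, sup_bot_eq] at this
    exact LinearMap.ker_eq_top.mp htop
  -- compare the coefficients of `z 1` at `g`
  have h1 := congrArg (fun f : Module.End ℂ (H → ℂ) => f (Pi.single 1 1) g) hz0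
  have hcoeff : ∀ a : H, (∑ x : H, ρ (x * a * x⁻¹)) (Pi.single 1 1 : H → ℂ) g =
      ((Finset.univ.filter fun x : H => x * a * x⁻¹ = g).card : ℂ) := by
    intro a
    rw [LinearMap.sum_apply, Finset.sum_apply, Finset.card_filter, Nat.cast_sum]
    refine Finset.sum_congr rfl fun x _ => ?_
    rw [hρ, leftTranslation_apply, Pi.single_apply, inv_mul_eq_one]
    split_ifs <;> simp
  simp only [hz, LinearMap.sub_apply, Pi.sub_apply, hcoeff, LinearMap.zero_apply,
    Pi.zero_apply, sub_eq_zero, Nat.cast_inj] at h1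
  have h2 : 0 < (Finset.univ.filter fun x : H => x * g * x⁻¹ = g).card :=
    Finset.card_pos.mpr ⟨1, by simp⟩
  rw [h1] at h2
  obtain ⟨x, hx⟩ := Finset.card_pos.mp h2
  exact (isConj_iff.mpr ⟨x, (Finset.mem_filter.mp hx).2⟩).symm

end Irreducible

/-! ### Degrees of irreducible characters -/

section Ito

open Representation

variable {H : Type*} [Group H] {V : Type*} [AddCommGroup V] [Module ℂ V] [FiniteDimensional ℂ V]

/-- The central element `∑ χ(g⁻¹) g` of the group algebra acts on the representation affording `χ`
as `|H| / χ(1)`. -/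
theorem sum_character_inv_smul [Fintype H] {ρ : Representation ℂ H V} (hρ : ρ.IsIrreducible) :
    ∑ g : H, ρ.character g⁻¹ • ρ g =
      ((Nat.card H : ℂ) / Module.finrank ℂ V) • (1 : Module.End ℂ V) := by
  have hV : Nontrivial V := ((isIrreducible_iff ρ).mp hρ).1
  have hcard : (Nat.card H : ℂ) ≠ 0 := Nat.cast_ne_zero.mpr Nat.card_pos.ne'
  have : Invertible (Nat.card H : ℂ) := invertibleOfNonzero hcard
  have hd : (Module.finrank ℂ V : ℂ) ≠ 0 := Nat.cast_ne_zero.mpr Module.finrank_pos.ne'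
  obtain ⟨c, hc⟩ := exists_eq_smul_one ρ hρ (∑ g : H, ρ.character g⁻¹ • ρ g) (by
    intro y
    rw [Finset.sum_mul, Finset.mul_sum]
    refine Fintype.sum_equiv (MulAut.conj y⁻¹).toEquiv _ _ fun x => ?_
    have h1 : (MulAut.conj y⁻¹).toEquiv x = y⁻¹ * x * y := by simp
    have h2 : (y⁻¹ * x * y)⁻¹ = y⁻¹ * x⁻¹ * y⁻¹⁻¹ := by group
    rw [h1, h2, char_conj, smul_mul_assoc, mul_smul_comm, ← map_mul, ← map_mul]
    congr 2
    group)
  have h1 := congrArg (LinearMap.trace ℂ V) hc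
  have h2 : ∑ g : H, ρ.character g * ρ.character g⁻¹ = Nat.card H := by
    have h3 := card_inv_mul_sum_char_mul_char_eq_finrank ρ ρ
    rw [IsIrreducible.finrank_intertwiningMap_self, Nat.cast_one, inv_mul_eq_one₀ hcard] at h3
    exact h3.symm
  rw [map_sum, map_smul, LinearMap.trace_one, smul_eq_mul] at h1
  have h4 : ∑ g : H, LinearMap.trace ℂ V (ρ.character g⁻¹ • ρ g) = Nat.card H := by
    rw [← h2]
    refine Finset.sum_congr rfl fun g _ => ?_
    rw [map_smul, smul_eq_mul, mul_comm]
    rfl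
  rw [hc, eq_div_iff_mul_eq hd |>.mpr (h1.symm.trans h4)]

/-- A commutative group acting on a nonzero space has a common eigenvector. -/
theorem exists_common_eigenvector [Nontrivial V] (Q : Subgroup H)
    (hQ : ∀ a ∈ Q, ∀ b ∈ Q, a * b = b * a) (ρ : Representation ℂ H V) :
    ∃ (v : V) (l : Q → ℂ), v ≠ 0 ∧ ∀ q : Q, ρ q v = l q • v := by
  let τ : Representation ℂ Q V := ρ.comp Q.subtype
  obtain ⟨W, hW⟩ := exists_isIrreducible_subrepresentation τ
  have : IsMulCommutative Q := ⟨⟨fun a b => Subtype.ext (hQ a a.2 b b.2)⟩⟩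
  have h1 : Module.finrank ℂ W.toSubmodule = 1 :=
    @IsIrreducible.finrank_eq_one_of_isMulCommutative _ _ _ _ _ _ _ W.toRepresentation hW _ _ _
  obtain ⟨w, hw, hw'⟩ := finrank_eq_one_iff'.mp h1
  choose l hl using fun q : Q => hw' (W.toRepresentation q w)
  refine ⟨w, l, fun h => hw (Subtype.ext h), fun q => ?_⟩
  have h2 := congrArg Subtype.val (hl q)
  exact h2.symm

section Weight

variable {V : Type*} [AddCommGroup V] [Module ℂ V]
  (ρ : Representation ℂ H V) (Q : Subgroup H) [Fintype Q] (l : Q → ℂ)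

/-- For a linear character `l` of `Q`, the projection of `V` onto the `l`-eigenspace of `Q`. -/
def weightProj : Module.End ℂ V :=
  (Nat.card Q : ℂ)⁻¹ • ∑ q : Q, l q • ρ ((q : H)⁻¹)

variable {ρ Q l}

theorem weightProj_mul (hmul : ∀ a b : Q, l (a * b) = l a * l b) (q : Q) :
    weightProj ρ Q l * ρ q = l q • weightProj ρ Q l := by
  rw [weightProj, smul_mul_assoc, smul_comm (l q), Finset.sum_mul]
  congr 1
  rw [Finset.smul_sum]
  refine Fintype.sum_equiv (Equiv.mulLeft q⁻¹) _ _ fun x => ?_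
  have h1 : l x = l q * l (q⁻¹ * x) := by rw [← hmul, mul_inv_cancel_left]
  rw [smul_smul, Equiv.coe_mulLeft, ← h1, smul_mul_assoc, ← map_mul]
  congr 2
  simp

theorem mul_weightProj (hmul : ∀ a b : Q, l (a * b) = l a * l b) (q : Q) :
    ρ q * weightProj ρ Q l = l q • weightProj ρ Q l := by
  rw [weightProj, mul_smul_comm, smul_comm (l q), Finset.mul_sum]
  congr 1
  rw [Finset.smul_sum]
  refine Fintype.sum_equiv (Equiv.mulRight q⁻¹) _ _ fun x => ?_
  have h1 : l x = l q * l (x * q⁻¹) := by rw [← mul_comm, ← hmul, inv_mul_cancel_right]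
  rw [smul_smul, Equiv.coe_mulRight, ← h1, mul_smul_comm, ← map_mul]
  congr 2
  simp

theorem weightProj_sq (hmul : ∀ a b : Q, l (a * b) = l a * l b) (hne : ∀ a : Q, l a ≠ 0) :
    weightProj ρ Q l * weightProj ρ Q l = weightProj ρ Q l := by
  have hcard : (Nat.card Q : ℂ) ≠ 0 := Nat.cast_ne_zero.mpr Nat.card_pos.ne'
  have hone : l 1 = 1 := by
    have := hmul 1 1
    rw [mul_one] at this
    exact (mul_eq_left₀ (hne 1)).mp this.symm
  conv_lhs => rhs; rw [weightProj]
  rw [mul_smul_comm, Finset.mul_sum]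
  have h1 : ∀ q ∈ (Finset.univ : Finset Q),
      weightProj ρ Q l * l q • ρ ((q : H)⁻¹) = weightProj ρ Q l := by
    intro q _
    have h2 := weightProj_mul (ρ := ρ) hmul q⁻¹
    rw [InvMemClass.coe_inv] at h2
    rw [mul_smul_comm, h2, smul_smul, ← hmul, mul_inv_cancel, hone, one_smul]
  rw [Finset.sum_congr rfl h1, Finset.sum_const, Finset.card_univ, ← Nat.card_eq_fintype_card,
    ← Nat.cast_smul_eq_nsmul ℂ, smul_smul, inv_mul_cancel₀ hcard, one_smul]

/-- An element `h` that stabilises `l` commutes with the projection, so the product has roots of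
unity and zero as eigenvalues; for the other elements the product is nilpotent. -/
theorem isIntegral_trace_weightProj_mul [Finite H] [FiniteDimensional ℂ V] [Q.Normal]
    (hmul : ∀ a b : Q, l (a * b) = l a * l b) (hne : ∀ a : Q, l a ≠ 0) (h : H) :
    IsIntegral ℤ (LinearMap.trace ℂ V (weightProj ρ Q l * ρ h)) := by
  have hsq := weightProj_sq (ρ := ρ) hmul hne
  by_cases hfix : ∀ q : Q, l ⟨h⁻¹ * q * h, by simpa using ‹Q.Normal›.conj_mem q q.2 h⁻¹⟩ = l q
  · -- `h` stabilises the weight `l`: the two factors commute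
    have hcomm : Commute (weightProj ρ Q l) (ρ h) := by
      rw [commute_iff_eq, weightProj, smul_mul_assoc, mul_smul_comm, Finset.sum_mul,
        Finset.mul_sum]
      congr 1
      refine Fintype.sum_equiv (MulAut.conjNormal h⁻¹).toEquiv _ _ fun x => ?_
      have h1 : ((MulAut.conjNormal h⁻¹).toEquiv x : Q) = ⟨h⁻¹ * x * h, by
          simpa using ‹Q.Normal›.conj_mem x x.2 h⁻¹⟩ := by
        apply Subtype.ext
        simp
      rw [h1, hfix, smul_mul_assoc, mul_smul_comm, ← map_mul, ← map_mul]
      congr 2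
      group
    apply isIntegral_trace_of_pow_eq (n := Nat.card H - 1)
    have hpow : ∀ k : ℕ, (weightProj ρ Q l) ^ (k + 1) = weightProj ρ Q l := by
      intro k
      induction k with
      | zero => rw [zero_add, pow_one]
      | succ k ih => rw [pow_succ, ih, hsq]
    have hn : Nat.card H - 1 + 3 = Nat.card H + 2 := by
      have := Nat.card_pos (α := H)
      omega
    rw [hcomm.mul_pow, hcomm.mul_pow, hn, hpow (Nat.card H + 1), hpow 1, ← map_pow, ← map_pow,
      pow_add, pow_card_eq_one', one_mul]
  · -- otherwise `h` moves the `l`-eigenspace to a different one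
    push Not at hfix
    obtain ⟨q, hq⟩ := hfix
    have h0 : weightProj ρ Q l * ρ h * weightProj ρ Q l = 0 := by
      set q' : Q := ⟨h⁻¹ * q * h, by simpa using ‹Q.Normal›.conj_mem q q.2 h⁻¹⟩ with hq'
      have h1 : weightProj ρ Q l * ρ q * ρ h * weightProj ρ Q l =
          l q • (weightProj ρ Q l * ρ h * weightProj ρ Q l) := by
        rw [weightProj_mul hmul, smul_mul_assoc, smul_mul_assoc]
      have h2 : weightProj ρ Q l * ρ q * ρ h * weightProj ρ Q l =
          l q' • (weightProj ρ Q l * ρ h * weightProj ρ Q l) := by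
        have h3 : ρ (q : H) * ρ h = ρ h * ρ (q' : H) := by
          rw [← map_mul, ← map_mul]
          congr 1
          simp only [hq']
          group
        rw [mul_assoc (weightProj ρ Q l), h3, mul_assoc, mul_assoc, mul_weightProj hmul,
          mul_smul_comm, mul_smul_comm, mul_assoc]
      have h4 := h1.symm.trans h2
      rw [← sub_eq_zero, ← sub_smul] at h4
      exact (smul_eq_zero.mp h4).resolve_left (sub_ne_zero.mpr hq.symm)
    have h2 : (weightProj ρ Q l * ρ h) ^ 2 = 0 := by
      rw [sq, ← mul_assoc, h0, zero_mul]
    apply isIntegral_trace_of_pow_eq (n := 0)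
    rw [pow_succ _ 2, h2, zero_mul]

end Weight

/-- Itô's theorem: the degree of an irreducible character divides the index of a commutative normal
subgroup. The quotient `[H : Q] / χ(1)` is the eigenvalue of `∑ tr(π c⁻¹) c` on a `Q`-eigenvector,
where `c` runs over representatives of `H / Q` and `π` is the projection onto the eigenspace; the
coefficients are algebraic integers. -/
theorem finrank_dvd_index [Finite H] {ρ : Representation ℂ H V} (hρ : ρ.IsIrreducible)
    (Q : Subgroup H) [Q.Normal] (hQ : ∀ a ∈ Q, ∀ b ∈ Q, a * b = b * a) :
    Module.finrank ℂ V ∣ Q.index := by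
  classical
  have := Fintype.ofFinite H
  have := Fintype.ofFinite Q
  have hV : Nontrivial V := ((isIrreducible_iff ρ).mp hρ).1
  have hd : Module.finrank ℂ V ≠ 0 := Module.finrank_pos.ne'
  have hcQ : (Nat.card Q : ℂ) ≠ 0 := Nat.cast_ne_zero.mpr Nat.card_pos.ne'
  obtain ⟨v, l, hv, hl⟩ := exists_common_eigenvector Q hQ ρ
  have hmul : ∀ a b : Q, l (a * b) = l a * l b := by
    intro a b
    have h1 := hl (a * b)
    rw [Subgroup.coe_mul, map_mul, Module.End.mul_apply, hl b, map_smul, hl a, smul_smul] at h1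
    rw [← smul_left_injective ℂ hv h1, mul_comm]
  have hne : ∀ a : Q, l a ≠ 0 := by
    intro a h0
    have h1 := hl a
    rw [h0, zero_smul] at h1
    have h2 : ρ ((a : H)⁻¹) (ρ a v) = v := by
      rw [← Module.End.mul_apply, ← map_mul, inv_mul_cancel, map_one, Module.End.one_apply]
    rw [h1, map_zero] at h2
    exact hv h2.symm
  let F : H → V := fun g => LinearMap.trace ℂ V (weightProj ρ Q l * ρ g⁻¹) • ρ g v
  -- averaging over `Q` replaces the coefficients `χ(g⁻¹)` by the traces `tr(π g⁻¹)`
  have hsum : ∑ g : H, F g = ((Nat.card H : ℂ) / Module.finrank ℂ V) • v := by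
    have h1 : ∀ q : Q, ∑ g : H, (l q * ρ.character ((q : H)⁻¹ * g⁻¹)) • ρ g v =
        ((Nat.card H : ℂ) / Module.finrank ℂ V) • v := by
      intro q
      have h2 := LinearMap.congr_fun (sum_character_inv_smul hρ) v
      rw [LinearMap.smul_apply, Module.End.one_apply, LinearMap.sum_apply] at h2
      rw [← h2]
      refine Fintype.sum_equiv (Equiv.mulRight (q : H)) _ _ fun g => ?_
      rw [Equiv.coe_mulRight, mul_inv_rev, LinearMap.smul_apply, map_mul, Module.End.mul_apply,
        hl q, map_smul, smul_smul, mul_comm]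
    have h3 : ∀ g : H, F g = (Nat.card Q : ℂ)⁻¹ •
        ∑ q : Q, (l q * ρ.character ((q : H)⁻¹ * g⁻¹)) • ρ g v := by
      intro g
      simp only [F]
      rw [weightProj, smul_mul_assoc, map_smul, Finset.sum_mul, map_sum, smul_eq_mul, mul_smul,
        Finset.sum_smul]
      congr 1
      refine Finset.sum_congr rfl fun q _ => ?_
      rw [smul_mul_assoc, map_smul, smul_eq_mul, ← map_mul]
      rfl
    rw [Finset.sum_congr rfl fun g _ => h3 g, ← Finset.smul_sum, Finset.sum_comm,
      Finset.sum_congr rfl fun q _ => h1 q, Finset.sum_const, Finset.card_univ,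
      ← Nat.card_eq_fintype_card, ← Nat.cast_smul_eq_nsmul ℂ, smul_smul, inv_mul_cancel₀ hcQ,
      one_smul]
  have hF : ∀ (g : H) (q : Q), F (g * q) = F g := by
    intro g q
    simp only [F]
    have h1 := weightProj_mul (ρ := ρ) hmul q⁻¹
    rw [InvMemClass.coe_inv] at h1
    have hone : l q⁻¹ * l q = 1 := by
      rw [← hmul, inv_mul_cancel]
      have := hmul 1 1
      rw [mul_one] at this
      exact (mul_eq_left₀ (hne 1)).mp this.symm
    rw [mul_inv_rev, map_mul ρ, ← mul_assoc, h1, map_mul ρ, Module.End.mul_apply, hl q, map_smul,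
      smul_mul_assoc, map_smul, smul_eq_mul, smul_smul, mul_right_comm, hone, one_mul]
  have hcos : ∑ g : H, F g = (Nat.card Q : ℂ) • ∑ c : H ⧸ Q, F c.out := by
    have hbij : Function.Bijective fun x : (H ⧸ Q) × Q => x.1.out * (x.2 : H) := by
      constructor
      · rintro ⟨c, q⟩ ⟨c', q'⟩ h
        have h1 : c = c' := by
          have := congrArg (QuotientGroup.mk (s := Q)) h
          simpa using this
        subst h1
        exact Prod.ext rfl (Subtype.ext (mul_left_cancel h))
      · intro g
        obtain ⟨q, hq⟩ := QuotientGroup.mk_out_eq_mul Q g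
        refine ⟨⟨g, q⁻¹⟩, ?_⟩
        change (g : H ⧸ Q).out * ((q⁻¹ : Q) : H) = g
        rw [hq, InvMemClass.coe_inv, mul_inv_cancel_right]
    rw [← Fintype.sum_bijective _ hbij (fun x => F x.1.out) F
      (fun x => (hF x.1.out x.2).symm), Fintype.sum_prod_type]
    simp only [Finset.sum_const, Finset.card_univ]
    rw [← Finset.smul_sum, ← Nat.card_eq_fintype_card, Nat.cast_smul_eq_nsmul]
  have hidx : (Nat.card H : ℂ) = Nat.card Q * Q.index := by
    exact_mod_cast (Subgroup.card_mul_index Q).symm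
  set μ : ℂ := (Q.index : ℂ) / Module.finrank ℂ V with hμ
  have hμv : ∑ c : H ⧸ Q, F c.out = μ • v := by
    have h1 := hcos.symm.trans hsum
    rw [hidx, mul_div_assoc, mul_smul] at h1
    exact smul_right_injective V hcQ h1
  -- the lattice spanned by the translates of `v` is stable under multiplication by `μ`
  have hint : IsIntegral (integralClosure ℤ ℂ) μ := by
    let N : Submodule (integralClosure ℤ ℂ) V := Submodule.span _ (Set.range fun g : H => ρ g v)
    refine isIntegral_of_smul_mem_submodule (M := V) N ?_ ?_ μ ?_
    · intro hbot
      have h1 : ρ 1 v ∈ N := Submodule.subset_span ⟨1, rfl⟩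
      rw [hbot, map_one, Submodule.mem_bot] at h1
      exact hv h1
    · exact Submodule.fg_span (Set.finite_range _)
    · intro w hw
      induction hw using Submodule.span_induction with
      | mem w hw =>
        obtain ⟨g, rfl⟩ := hw
        change μ • ρ g v ∈ N
        rw [← map_smul, ← hμv, map_sum]
        refine Submodule.sum_mem _ fun c _ => ?_
        simp only [F]
        rw [map_smul, ← Module.End.mul_apply, ← map_mul]
        exact N.smul_mem (⟨_, isIntegral_trace_weightProj_mul hmul hne _⟩ : integralClosure ℤ ℂ)
          (Submodule.subset_span ⟨g * c.out, rfl⟩)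
      | zero => rw [smul_zero]; exact N.zero_mem
      | add a b _ _ ha hb => rw [smul_add]; exact N.add_mem ha hb
      | smul a b _ hb => rw [smul_comm]; exact N.smul_mem a hb
  have hint' : IsIntegral ℤ μ := isIntegral_trans μ hint
  have hq : μ = algebraMap ℚ ℂ ((Q.index : ℚ) / Module.finrank ℂ V) := by
    rw [hμ, map_div₀, map_natCast, map_natCast]
  rw [hq, isIntegral_algebraMap_iff (algebraMap ℚ ℂ).injective,
    IsIntegrallyClosed.isIntegral_iff] at hint'
  obtain ⟨k, hk⟩ := hint'
  have hk' : (k : ℚ) * Module.finrank ℂ V = Q.index := by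
    rw [← eq_div_iff (Nat.cast_ne_zero.mpr hd), ← hk]
    rfl
  have hk'' : k * (Module.finrank ℂ V : ℤ) = (Q.index : ℤ) := by exact_mod_cast hk'
  exact_mod_cast Dvd.intro_left k hk''

theorem finrank_dvd_card [Finite H] {ρ : Representation ℂ H V} (hρ : ρ.IsIrreducible) :
    Module.finrank ℂ V ∣ Nat.card H := by
  rw [← Subgroup.index_bot]
  refine finrank_dvd_index hρ ⊥ fun a ha b hb => ?_
  rw [Subgroup.mem_bot.mp ha, Subgroup.mem_bot.mp hb]

end Ito

/-! ### Linear constituents of representations of `p`-groups -/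

section LinearConstituents

open Representation

variable {P : Type*} [Group P] {V : Type*} [AddCommGroup V] [Module ℂ V]

/-- The representation `λ⁻¹ ⊗ ρ`, for a linear character `λ`. Its invariants are the vectors on
which the group acts through `λ`. -/
def twist (l : P →* ℂˣ) (ρ : Representation ℂ P V) : Representation ℂ P V where
  toFun u := ((l u)⁻¹ : ℂˣ).val • ρ u
  map_one' := by simp
  map_mul' u w := by
    rw [map_mul, map_mul, mul_inv, Units.val_mul, smul_mul_smul_comm]

theorem twist_apply (l : P →* ℂˣ) (ρ : Representation ℂ P V) (u : P) :
    twist l ρ u = ((l u)⁻¹ : ℂˣ).val • ρ u := rfl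

theorem mem_invariants_twist_iff {l : P →* ℂˣ} {ρ : Representation ℂ P V} {v : V} :
    v ∈ (twist l ρ).invariants ↔ ∀ u, ρ u v = (l u).val • v := by
  rw [Representation.mem_invariants]
  refine forall_congr' fun u => ?_
  rw [twist_apply, LinearMap.smul_apply, Units.val_inv_eq_inv_val, inv_smul_eq_iff₀ (l u).ne_zero]

/-- The multiplicity of the linear character `λ` in `ρ`. -/
def linMult (l : P →* ℂˣ) (ρ : Representation ℂ P V) : ℕ :=
  Module.finrank ℂ (twist l ρ).invariants

theorem finrank_eq_one_of_linMult_ne_zero {ρ : Representation ℂ P V} (hρ : ρ.IsIrreducible)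
    {l : P →* ℂˣ} (hl : linMult l ρ ≠ 0) : Module.finrank ℂ V = 1 := by
  have h1 : (twist l ρ).invariants ≠ ⊥ := fun h0 => hl (by rw [linMult, h0, finrank_bot])
  obtain ⟨v, hv, hv0⟩ := Submodule.exists_mem_ne_zero_of_ne_bot h1
  rw [mem_invariants_twist_iff] at hv
  rcases ((isIrreducible_iff ρ).mp hρ).2 (Submodule.span ℂ {v}) (fun u w hw => by
    obtain ⟨c, rfl⟩ := Submodule.mem_span_singleton.mp hw
    rw [map_smul, hv u]
    exact Submodule.smul_mem _ _ (Submodule.smul_mem _ _ (Submodule.mem_span_singleton_self v)))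
    with h2 | h2
  · exact absurd (Submodule.span_singleton_eq_bot.mp h2) hv0
  · rw [← finrank_top ℂ V, ← h2, finrank_span_singleton hv0]

variable [FiniteDimensional ℂ V]

theorem linMult_cast [Fintype P] (l : P →* ℂˣ) (ρ : Representation ℂ P V) :
    (linMult l ρ : ℂ) = (Nat.card P : ℂ)⁻¹ * ∑ u : P, ((l u)⁻¹ : ℂˣ).val * ρ.character u := by
  have : Invertible (Nat.card P : ℂ) :=
    invertibleOfNonzero (Nat.cast_ne_zero.mpr Nat.card_pos.ne')
  rw [linMult, ← card_inv_mul_sum_char_eq_finrank]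
  congr 1
  refine Finset.sum_congr rfl fun u _ => ?_
  rw [Representation.character, twist_apply, map_smul, smul_eq_mul]
  rfl

theorem character_eq_add_of_isCompl {ρ : Representation ℂ P V} {W U : Subrepresentation ρ}
    (h : IsCompl W.toSubmodule U.toSubmodule) (u : P) :
    ρ.character u = W.toRepresentation.character u + U.toRepresentation.character u := by
  have h1 : ρ u = (Submodule.prodEquivOfIsCompl _ _ h).conj
      ((W.toRepresentation u).prodMap (U.toRepresentation u)) := by
    ext v
    obtain ⟨x, rfl⟩ := (Submodule.prodEquivOfIsCompl _ _ h).surjective v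
    rw [LinearEquiv.conj_apply_apply, LinearEquiv.symm_apply_apply, LinearMap.prodMap_apply,
      Submodule.coe_prodEquivOfIsCompl', Submodule.coe_prodEquivOfIsCompl', map_add]
    rfl
  rw [Representation.character, h1, LinearMap.trace_conj', LinearMap.trace_prodMap']
  rfl

theorem linMult_eq_add_of_isCompl [Finite P] (l : P →* ℂˣ) {ρ : Representation ℂ P V}
    {W U : Subrepresentation ρ} (h : IsCompl W.toSubmodule U.toSubmodule) :
    linMult l ρ = linMult l W.toRepresentation + linMult l U.toRepresentation := by
  have := Fintype.ofFinite P
  have h1 : (linMult l ρ : ℂ) = linMult l W.toRepresentation + linMult l U.toRepresentation := by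
    rw [linMult_cast, linMult_cast, linMult_cast, ← mul_add, ← Finset.sum_add_distrib]
    congr 1
    refine Finset.sum_congr rfl fun u _ => ?_
    rw [character_eq_add_of_isCompl h, mul_add]
  exact_mod_cast h1

theorem finite_linearCharacters [Finite P] : Finite (P →* ℂˣ) := by
  have : NeZero (Nat.card P) := ⟨Nat.card_pos.ne'⟩
  let f : (P →* ℂˣ) → P → rootsOfUnity (Nat.card P) ℂ := fun l u =>
    ⟨l u, by rw [mem_rootsOfUnity, ← map_pow, pow_card_eq_one', map_one]⟩
  refine Finite.of_injective f fun l l' h => ?_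
  ext u
  exact congrArg (fun x : rootsOfUnity (Nat.card P) ℂ => (x : ℂˣ).val) (congrFun h u)

/-- A one-dimensional representation has exactly one linear constituent. -/
theorem sum_linMult_of_finrank_eq_one [Fintype (P →* ℂˣ)] {ρ : Representation ℂ P V}
    (hd : Module.finrank ℂ V = 1) : ∑ l : P →* ℂˣ, linMult l ρ = 1 := by
  obtain ⟨v, hv, hspan⟩ := finrank_eq_one_iff'.mp hd
  choose c hc using fun u : P => hspan (ρ u v)
  have hcm : ∀ u w, c (u * w) = c u * c w := by
    intro u w
    have h1 := hc (u * w)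
    rw [map_mul, Module.End.mul_apply, ← hc w, map_smul, ← hc u, smul_smul] at h1
    rw [smul_left_injective ℂ hv h1, mul_comm]
  have hc1 : c 1 = 1 := by
    have h1 := hc 1
    rw [map_one, Module.End.one_apply] at h1
    exact smul_left_injective ℂ hv (h1.trans (one_smul ℂ v).symm)
  let μ : P →* ℂˣ := MonoidHom.toHomUnits
    { toFun := c, map_one' := hc1, map_mul' := hcm }
  have hμ : ∀ u, (μ u).val = c u := fun u => rfl
  rw [Finset.sum_eq_single μ]
  · have h1 : (twist μ ρ).invariants = ⊤ := by
      rw [eq_top_iff]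
      intro w _
      rw [mem_invariants_twist_iff]
      intro u
      obtain ⟨a, rfl⟩ := hspan w
      rw [map_smul, ← hc u, hμ, smul_comm]
    rw [linMult, h1, finrank_top, hd]
  · intro l _ hl
    rw [linMult]
    have h1 : (twist l ρ).invariants = ⊥ := by
      rw [eq_bot_iff]
      intro w hw
      rw [mem_invariants_twist_iff] at hw
      by_contra hw0
      rw [Submodule.mem_bot] at hw0
      obtain ⟨a, rfl⟩ := hspan w
      refine hl (MonoidHom.ext fun u => Units.ext ?_)
      have h2 := hw u
      rw [map_smul, ← hc u, smul_comm] at h2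
      exact (smul_left_injective ℂ hw0 h2).symm
    rw [h1, finrank_bot]
  · intro h
    exact absurd (Finset.mem_univ _) h

/-- Modulo `p`, the degree of a representation of a `p`-group is the number of its linear
constituents, since the other constituents have degree a nontrivial power of `p`. -/
theorem finrank_modEq_sum_linMult {p : ℕ} (hp : p.Prime) [Finite P]
    [Fintype (P →* ℂˣ)] (hP : IsPGroup p P) : ∀ (d : ℕ) {V : Type*} [AddCommGroup V] [Module ℂ V]
    [FiniteDimensional ℂ V] (ρ : Representation ℂ P V), Module.finrank ℂ V = d →
    d ≡ ∑ l : P →* ℂˣ, linMult l ρ [MOD p] := by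
  intro d
  induction d using Nat.strong_induction_on with
  | _ d ih =>
    intro V _ _ _ ρ hd
    have : Fact p.Prime := ⟨hp⟩
    rcases Nat.eq_zero_or_pos d with rfl | hpos
    · have : ∀ l : P →* ℂˣ, linMult l ρ = 0 := fun l =>
        Nat.eq_zero_of_le_zero ((Submodule.finrank_le _).trans hd.le)
      simp [this]
      rfl
    by_cases hirr : ρ.IsIrreducible
    · by_cases hd1 : d = 1
      · subst hd1
        rw [sum_linMult_of_finrank_eq_one hd]
      · have h0 : ∀ l : P →* ℂˣ, linMult l ρ = 0 := fun l => by
          by_contra h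
          exact hd1 (hd.symm.trans (finrank_eq_one_of_linMult_ne_zero hirr h))
        obtain ⟨k, hk⟩ := hP.exists_card_eq
        have h1 : d ∣ p ^ k := by
          rw [← hk, ← hd]
          exact finrank_dvd_card hirr
        obtain ⟨j, -, rfl⟩ := (Nat.dvd_prime_pow hp).mp h1
        rw [Finset.sum_congr rfl fun l _ => h0 l, Finset.sum_const_zero]
        refine (Nat.modEq_zero_iff_dvd).mpr (dvd_pow_self p ?_)
        rintro rfl
        exact hd1 (pow_zero p)
    · have hV : Nontrivial V := Module.nontrivial_of_finrank_pos (R := ℂ) (hd ▸ hpos)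
      obtain ⟨W, hW⟩ := exists_isIrreducible_subrepresentation ρ
      obtain ⟨U, hU⟩ := exists_isCompl_subrepresentation W
      have hsum := Submodule.finrank_add_eq_of_isCompl hU
      have hWpos : 0 < Module.finrank ℂ W.toSubmodule := by
        have := ((isIrreducible_iff _).mp hW).1
        exact Module.finrank_pos
      have hUpos : 0 < Module.finrank ℂ U.toSubmodule := by
        rw [Nat.pos_iff_ne_zero]
        intro h0
        have h1 : U.toSubmodule = ⊥ := Submodule.finrank_eq_zero.mp h0
        have h2 : W.toSubmodule = ⊤ := by
          have := hU.sup_eq_top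
          rwa [h1, sup_bot_eq] at this
        exact hirr (isIrreducible_conj hW ρ (LinearEquiv.ofTop _ h2) fun g v => rfl)
      have hWm := ih _ (by omega) W.toRepresentation rfl
      have hUm := ih _ (by omega) U.toRepresentation rfl
      rw [← hd, ← hsum, Finset.sum_congr rfl fun l _ => linMult_eq_add_of_isCompl l hU,
        Finset.sum_add_distrib]
      exact hWm.add hUm

theorem linMult_pow [Finite P] {ρ : Representation ℂ P V} {k : ℕ} (hk : (Nat.card P).Coprime k)
    (hχ : ∀ u, ρ.character (u ^ k) = ρ.character u) (l : P →* ℂˣ) :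
    linMult (l ^ k) ρ = linMult l ρ := by
  have := Fintype.ofFinite P
  have h1 : (linMult (l ^ k) ρ : ℂ) = linMult l ρ := by
    rw [linMult_cast, linMult_cast]
    congr 1
    refine Fintype.sum_equiv (powCoprime hk) _ _ fun u => ?_
    rw [powCoprime_apply, hχ, map_pow, MonoidHom.pow_apply]
  exact_mod_cast h1

/-- If the character of a representation of a `p`-group is invariant under `u ↦ u ^ (1 + p)` and its
degree is not divisible by `p`, then one of its constituents is a linear character of order dividing
`p`: the map `λ ↦ λ ^ (1 + p)` has `p`-power order and permutes the linear characters of given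
multiplicity, so it fixes some constituent `λ`. -/
theorem exists_linMult_ne_zero {p : ℕ} (hp : p.Prime) [Finite P] (hP : IsPGroup p P)
    {ρ : Representation ℂ P V} (hd : ¬ p ∣ Module.finrank ℂ V)
    (hχ : ∀ u, ρ.character (u ^ (1 + p)) = ρ.character u) :
    ∃ l : P →* ℂˣ, (∀ u, l u ^ p = 1) ∧ linMult l ρ ≠ 0 := by
  classical
  have : Fact p.Prime := ⟨hp⟩
  have := finite_linearCharacters (P := P)
  have := Fintype.ofFinite (P →* ℂˣ)
  obtain ⟨a, ha⟩ := hP.exists_card_eq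
  have hcop : (Nat.card P).Coprime (1 + p) := by
    rw [ha]
    refine Nat.Coprime.pow_left a ?_
    rw [Nat.coprime_add_self_right]
    exact Nat.coprime_one_right p
  by_contra hcon
  push Not at hcon
  refine hd ((Nat.modEq_zero_iff_dvd).mp
    ((finrank_modEq_sum_linMult hp hP _ ρ rfl).trans ((Nat.modEq_zero_iff_dvd).mpr ?_)))
  rw [Finset.sum_comp (fun c : ℕ => c) (fun l : P →* ℂˣ => linMult l ρ)]
  refine Finset.dvd_sum fun c _ => ?_
  rw [smul_eq_mul]
  rcases Nat.eq_zero_or_pos c with rfl | hc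
  · exact dvd_zero _ |>.trans (by simp)
  refine Dvd.dvd.mul_right ?_ c
  -- the action of `λ ↦ λ ^ (1 + p)` on the linear characters of multiplicity `c`
  let S : Type _ := {l : P →* ℂˣ // linMult l ρ = c}
  let f : Function.End S := fun l => ⟨l.1 ^ (1 + p), (linMult_pow hcop hχ l.1).trans l.2⟩
  have hfpow : ∀ (n : ℕ) (l : S) (u : P),
      ((f ^ n : Function.End S) l).1 u = l.1 u ^ ((1 + p) ^ n) := by
    intro n
    induction n with
    | zero => intro l u; rw [pow_zero, pow_zero, pow_one]; rfl
    | succ n ih =>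
      intro l u
      rw [pow_succ']
      change (((f ^ n : Function.End S) l).1 ^ (1 + p)) u = _
      rw [MonoidHom.pow_apply, ih, ← pow_mul, ← pow_succ]
  have hf : f ^ p ^ a = 1 := by
    funext l
    apply Subtype.ext
    refine MonoidHom.ext fun u => ?_
    rw [hfpow]
    change _ = l.1 u
    have h1 : (1 + p) ^ p ^ a ≡ 1 [MOD p ^ a] := by
      have h2 : ((1 + p : ℕ) : ℤ) ^ p ^ a ≡ (1 : ℤ) ^ p ^ a [ZMOD (p ^ (a + 1) : ℕ)] := by
        have h3 : (p : ℤ) ∣ ((1 + p : ℕ) : ℤ) - 1 := by push_cast; simp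
        have h4 := dvd_sub_pow_of_dvd_sub h3 a
        exact ((Int.modEq_iff_dvd.mpr (by exact_mod_cast h4)).symm)
      rw [one_pow] at h2
      have h5 : (1 + p) ^ p ^ a ≡ 1 [MOD p ^ (a + 1)] := by
        apply (Int.natCast_modEq_iff).mp
        exact_mod_cast h2
      exact h5.of_dvd (pow_dvd_pow p (Nat.le_succ a))
    have h6 : l.1 u ^ p ^ a = 1 := by rw [← map_pow, ← ha, pow_card_eq_one', map_one]
    have h7 : l.1 u ^ (1 + p) ^ p ^ a = l.1 u ^ 1 := by
      rw [pow_eq_pow_iff_modEq]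
      exact h1.of_dvd (orderOf_dvd_of_pow_eq_one h6)
    rw [h7, pow_one]
  have h1 := Equiv.Perm.card_fixedPoints_modEq hf
  have h2 : IsEmpty (Function.fixedPoints f) := by
    refine ⟨fun l => ?_⟩
    have h3 : l.1.1 ^ (1 + p) = l.1.1 := congrArg Subtype.val l.2
    have h4 : ∀ u, l.1.1 u ^ p = 1 := by
      intro u
      have h5 := DFunLike.congr_fun h3 u
      rw [MonoidHom.pow_apply, pow_add, pow_one] at h5
      exact mul_eq_left.mp h5
    exact hc.ne' (l.1.2.symm.trans (hcon _ h4))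
  rw [Fintype.card_eq_zero (α := Function.fixedPoints f), Nat.modEq_zero_iff_dvd,
    Fintype.card_subtype] at h1
  exact h1

end LinearConstituents

/-! ### Frattini subgroups of `p`-groups -/

section Frattini

theorem map_eq_one_of_mem_frattini {P : Type*} [Group P] {p : ℕ} (hp : p.Prime) (l : P →* ℂˣ)
    (hl : ∀ u, l u ^ p = 1) {u : P} (hu : u ∈ frattini P) : l u = 1 := by
  have : Fact p.Prime := ⟨hp⟩
  by_cases htriv : l.ker = ⊤
  · have : u ∈ l.ker := htriv ▸ Subgroup.mem_top u
    exact this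
  · have hco : IsCoatom l.ker := by
      refine ⟨htriv, fun K hK => ?_⟩
      obtain ⟨x, hxK, hx⟩ := Set.exists_of_ssubset hK
      have hprim : IsPrimitiveRoot (l x) p := by
        rw [← orderOf_eq_prime (hl x) hx]
        exact IsPrimitiveRoot.orderOf (l x)
      rw [eq_top_iff]
      intro y _
      have : NeZero p := ⟨hp.ne_zero⟩
      obtain ⟨i, -, hi⟩ := (hprim.map_of_injective (f := Units.coeHom ℂ)
        Units.val_injective).eq_pow_of_pow_eq_one
        (show (l y : ℂ) ^ p = 1 by rw [← Units.val_pow_eq_pow_val, hl, Units.val_one])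
      rw [Units.coeHom_apply, ← Units.val_pow_eq_pow_val, Units.val_inj] at hi
      have h1 : y * (x ^ i)⁻¹ ∈ K := by
        apply hK.le
        rw [MonoidHom.mem_ker, map_mul, map_inv, map_pow, hi, mul_inv_cancel]
      have h2 := K.mul_mem h1 (K.pow_mem hxK i)
      rwa [inv_mul_cancel_right] at h2
    exact frattini_le_coatom hco hu

/-- If `χ` has degree prime to `p` and is invariant under `u ↦ u ^ (1 + p)` on a normal `p`-subgroup
`P`, then the Frattini subgroup of `P` lies in the kernel of `χ`. -/
theorem frattini_acts_trivially {H : Type*} [Group H] [Finite H] {V : Type*} [AddCommGroup V]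
    [Module ℂ V] [FiniteDimensional ℂ V] {ρ : Representation ℂ H V} (hρ : ρ.IsIrreducible) {p : ℕ}
    (hp : p.Prime) (P : Subgroup H) [P.Normal] (hP : IsPGroup p P)
    (hd : ¬ p ∣ Module.finrank ℂ V) (hχ : ∀ u ∈ P, ρ.character (u ^ (1 + p)) = ρ.character u)
    {u : H} (hu : u ∈ (frattini P).map P.subtype) : ρ u = 1 := by
  let τ : Representation ℂ P V := ρ.comp P.subtype
  obtain ⟨l, hl, hml⟩ := exists_linMult_ne_zero hp hP (ρ := τ) hd (fun w => hχ w w.2)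
  have h1 : (twist l τ).invariants ≠ ⊥ := fun h0 => hml (by rw [linMult, h0, finrank_bot])
  obtain ⟨v, hv, hv0⟩ := Submodule.exists_mem_ne_zero_of_ne_bot h1
  rw [mem_invariants_twist_iff] at hv
  -- the fixed vectors of the normal subgroup `Φ(P)` form a subrepresentation
  let W : Submodule ℂ V :=
    { carrier := {w | ∀ x ∈ (frattini P).map P.subtype, ρ x w = w}
      add_mem' := fun {a b} ha hb x hx => by rw [map_add, ha x hx, hb x hx]
      zero_mem' := fun x _ => map_zero _
      smul_mem' := fun c a ha x hx => by rw [map_smul, ha x hx] }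
  have hmem : ∀ w, w ∈ W ↔ ∀ x ∈ (frattini P).map P.subtype, ρ x w = w := fun w => Iff.rfl
  have hn : ((frattini P).map P.subtype).Normal := inferInstance
  have hinv : ∀ g, ∀ w ∈ W, ρ g w ∈ W := by
    intro g w hw x hx
    have h2 := hw _ (hn.conj_mem x hx g⁻¹)
    calc ρ x (ρ g w) = ρ g (ρ (g⁻¹ * x * g⁻¹⁻¹) w) := by
          rw [← Module.End.mul_apply, ← Module.End.mul_apply, ← map_mul, ← map_mul]
          congr 2
          group
      _ = ρ g w := by rw [h2]
  rcases ((isIrreducible_iff ρ).mp hρ).2 W hinv with h2 | h2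
  · have h3 : v ∈ W := by
      rintro _ ⟨x, hx, rfl⟩
      have h4 := hv x
      rw [map_eq_one_of_mem_frattini hp l hl hx, Units.val_one, one_smul] at h4
      exact h4
    rw [h2, Submodule.mem_bot] at h3
    exact absurd h3 hv0
  · ext w
    have h3 : w ∈ W := h2 ▸ Submodule.mem_top
    exact h3 u hu

/-- A maximal subgroup of a finite `p`-group is normal of index `p`; so it contains all `p`-th
powers and all commutators. -/
theorem pow_mem_and_commutator_mem_of_isCoatom {P : Type*} [Group P] [Finite P] {p : ℕ}
    (hp : p.Prime) (hP : IsPGroup p P) {M : Subgroup P} (hM : IsCoatom M) (x y : P) :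
    x ^ p ∈ M ∧ x * y * x⁻¹ * y⁻¹ ∈ M := by
  have : Fact p.Prime := ⟨hp⟩
  have hnil : Group.IsNilpotent P := hP.isNilpotent
  have hnorm : M.Normal :=
    Subgroup.NormalizerCondition.normal_of_coatom M Group.normalizerCondition_of_isNilpotent hM
  have hsurj := QuotientGroup.mk'_surjective M
  have hsub : ∀ K : Subgroup (P ⧸ M), K = ⊥ ∨ K = ⊤ := by
    intro K
    have h1 : M ≤ K.comap (QuotientGroup.mk' M) := by
      conv_lhs => rw [← QuotientGroup.ker_mk' M]
      exact Subgroup.ker_le_comap _ K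
    rcases hM.le_iff.mp h1 with h2 | h2
    · right
      rw [← Subgroup.map_comap_eq_self_of_surjective hsurj K, h2,
        Subgroup.map_top_of_surjective _ hsurj]
    · left
      rw [← Subgroup.map_comap_eq_self_of_surjective hsurj K, h2, QuotientGroup.map_mk'_self]
  -- a group without proper nontrivial subgroups is cyclic of prime order
  have hnt : Nontrivial (P ⧸ M) := by
    by_contra h
    rw [not_nontrivial_iff_subsingleton] at h
    exact hM.1 (QuotientGroup.subsingleton_iff.mp h)
  obtain ⟨k, hk, hcard⟩ := (hP.to_quotient M).nontrivial_iff_card.mp hnt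
  obtain ⟨g, hg⟩ := exists_prime_orderOf_dvd_card' (G := P ⧸ M) p
    (hcard ▸ dvd_pow_self p hk.ne')
  have hgtop : Subgroup.zpowers g = ⊤ := by
    refine (hsub _).resolve_left fun h => ?_
    rw [Subgroup.zpowers_eq_bot] at h
    rw [h, orderOf_one] at hg
    exact hp.one_lt.ne hg
  have hmem : ∀ x : P ⧸ M, ∃ i : ℤ, g ^ i = x := fun x =>
    Subgroup.mem_zpowers_iff.mp (hgtop ▸ Subgroup.mem_top x)
  constructor
  · rw [← QuotientGroup.eq_one_iff, QuotientGroup.mk_pow]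
    obtain ⟨i, hi⟩ := hmem x
    rw [← hi, ← zpow_natCast, ← zpow_mul, mul_comm, zpow_mul, zpow_natCast, ← hg,
      pow_orderOf_eq_one, one_zpow]
  · rw [← QuotientGroup.eq_one_iff]
    obtain ⟨i, hi⟩ := hmem x
    obtain ⟨j, hj⟩ := hmem y
    rw [QuotientGroup.mk_mul, QuotientGroup.mk_mul, QuotientGroup.mk_mul, QuotientGroup.mk_inv,
      QuotientGroup.mk_inv, ← hi, ← hj]
    group

theorem pow_mem_frattini {P : Type*} [Group P] [Finite P] {p : ℕ} (hp : p.Prime)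
    (hP : IsPGroup p P) (x : P) : x ^ p ∈ frattini P := by
  rw [frattini, Order.radical, Subgroup.mem_iInf]
  intro M
  rw [Subgroup.mem_iInf]
  exact fun hM => (pow_mem_and_commutator_mem_of_isCoatom hp hP hM x x).1

theorem commutator_mem_frattini {P : Type*} [Group P] [Finite P] {p : ℕ} (hp : p.Prime)
    (hP : IsPGroup p P) (x y : P) : x * y * x⁻¹ * y⁻¹ ∈ frattini P := by
  rw [frattini, Order.radical, Subgroup.mem_iInf]
  intro M
  rw [Subgroup.mem_iInf]
  exact fun hM => (pow_mem_and_commutator_mem_of_isCoatom hp hP hM x y).2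

end Frattini

/-! ### The local condition as a statement about conjugacy of powers -/

section Local

variable {K : Type*} [Group K]

theorem conj_pow_mem {x y : K} {n : ℕ} {h : K} (hxy : h * x * h⁻¹ = y) :
    h * x ^ n * h⁻¹ = y ^ n := by
  rw [← hxy, conj_pow]

theorem mem_normalizer_zpowers_of_conj_eq [Finite K] {y n : K} {t : ℕ} (h : n * y * n⁻¹ = y ^ t) :
    n ∈ Subgroup.normalizer (Subgroup.zpowers y : Set K) := by
  have hle : (Subgroup.zpowers y).map (MulAut.conj n).toMonoidHom ≤ Subgroup.zpowers y := by
    rw [MonoidHom.map_zpowers, Subgroup.zpowers_le]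
    exact Subgroup.mem_zpowers_iff.mpr ⟨t, by rw [zpow_natCast]; exact h.symm⟩
  have heq : (Subgroup.zpowers y).map (MulAut.conj n).toMonoidHom = Subgroup.zpowers y := by
    apply Subgroup.eq_of_le_of_card_ge hle
    rw [Subgroup.card_map_of_injective (MulAut.conj n).injective]
  rw [Subgroup.mem_normalizer_iff]
  intro z
  constructor
  · intro hz
    rw [← heq]
    exact ⟨z, hz, rfl⟩
  · intro hz
    rw [← heq] at hz
    obtain ⟨w, hw, hwz⟩ := hz
    have : w = z := (MulAut.conj n).injective hwz
    exact this ▸ hw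

theorem exists_conj_eq_pow_of_mem_normalizer [Finite K] {y n : K}
    (hn : n ∈ Subgroup.normalizer (Subgroup.zpowers y : Set K)) : ∃ t : ℕ, n * y * n⁻¹ = y ^ t := by
  have h1 : n * y * n⁻¹ ∈ Subgroup.zpowers y :=
    (Subgroup.mem_normalizer_iff.mp hn y).mp (Subgroup.mem_zpowers y)
  obtain ⟨t, ht⟩ := (mem_powers_iff_mem_zpowers.mpr h1 : n * y * n⁻¹ ∈ Submonoid.powers y)
  exact ⟨t, ht.symm⟩

theorem centralizer_zpowers (y : K) :
    Subgroup.centralizer (Subgroup.zpowers y : Set K) = Subgroup.centralizer {y} := by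
  rw [Subgroup.zpowers_eq_closure, Subgroup.centralizer_closure]

/-- The conjugation action of `N_K(⟨y⟩)` on `⟨y⟩` has kernel `C_K(y)`, so `N_K(⟨y⟩) / C_K(y)` is
isomorphic to `Aut(⟨y⟩)` if and only if this action induces all automorphisms. -/
theorem normalizerInducesAut_iff_surjective [Finite K] (y : K) :
    NormalizerInducesAut y ↔
      Function.Surjective (Subgroup.zpowers y).normalizerMonoidHom := by
  have hker : (Subgroup.centralizer {y}).subgroupOf
      (Subgroup.normalizer (Subgroup.zpowers y : Set K)) =
      (Subgroup.zpowers y).normalizerMonoidHom.ker := by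
    rw [Subgroup.normalizerMonoidHom_ker, centralizer_zpowers]
  have hfin : Finite (MulAut (Subgroup.zpowers y)) :=
    Finite.of_injective (fun f : MulAut (Subgroup.zpowers y) => (f : _ → Subgroup.zpowers y))
      DFunLike.coe_injective
  constructor
  · rintro ⟨e⟩
    rw [← MonoidHom.range_eq_top]
    apply Subgroup.eq_top_of_card_eq
    rw [← Nat.card_congr e.toEquiv, ← Nat.card_congr
      (QuotientGroup.quotientKerEquivRange (Subgroup.zpowers y).normalizerMonoidHom).toEquiv,
      Nat.card_congr (QuotientGroup.quotientMulEquivOfEq hker).toEquiv]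
  · intro h
    exact ⟨(QuotientGroup.quotientMulEquivOfEq hker).trans
      (QuotientGroup.quotientKerEquivOfSurjective _ h)⟩

theorem exists_conj_eq_pow_of_normalizerInducesAut [Finite K] {y : K} {k : ℕ}
    (hk : (orderOf y).Coprime k) (h : NormalizerInducesAut y) : ∃ n : K, n * y * n⁻¹ = y ^ k := by
  rw [normalizerInducesAut_iff_surjective] at h
  have hcard : (Nat.card (Subgroup.zpowers y)).Coprime k := by rwa [Nat.card_zpowers]
  let α : MulAut (Subgroup.zpowers y) :=
    { powCoprime hcard with
      map_mul' := fun a b => by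
        change (a * b) ^ k = a ^ k * b ^ k
        obtain ⟨a, i, rfl⟩ := a
        obtain ⟨b, j, rfl⟩ := b
        refine Commute.mul_pow (Subtype.ext ?_) k
        exact (Commute.refl y).zpow_zpow i j }
  obtain ⟨n, hn⟩ := h α
  refine ⟨n, ?_⟩
  have h1 := congrArg Subtype.val (DFunLike.congr_fun hn ⟨y, Subgroup.mem_zpowers y⟩)
  exact h1

theorem normalizerInducesAut_of_forall_exists_conj [Finite K] {y : K}
    (h : ∀ t : ℕ, (orderOf y).Coprime t → ∃ n : K, n * y * n⁻¹ = y ^ t) :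
    NormalizerInducesAut y := by
  rw [normalizerInducesAut_iff_surjective]
  intro α
  let y₀ : Subgroup.zpowers y := ⟨y, Subgroup.mem_zpowers y⟩
  obtain ⟨t, ht⟩ := (mem_powers_iff_mem_zpowers.mpr (α y₀).2 : (α y₀ : K) ∈ Submonoid.powers y)
  change y ^ t = (α y₀ : K) at ht
  have hord : orderOf (y ^ t) = orderOf y := by
    rw [ht, Subgroup.orderOf_coe, MulEquiv.orderOf_eq, ← Subgroup.orderOf_coe]
  have hcop : (orderOf y).Coprime t := by
    rw [orderOf_pow] at hord
    exact (Nat.div_eq_self.mp hord).resolve_left (orderOf_pos y).ne'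
  obtain ⟨n, hn⟩ := h t hcop
  refine ⟨⟨n, mem_normalizer_zpowers_of_conj_eq hn⟩, ?_⟩
  ext ⟨_, i, rfl⟩
  have h1 : (⟨y ^ i, i, rfl⟩ : Subgroup.zpowers y) = y₀ ^ i := Subtype.ext rfl
  change n * y ^ i * n⁻¹ = _
  rw [← conj_zpow, hn, h1, map_zpow, Subgroup.coe_zpow, ← ht]

theorem normalizerFixesClasses_iff (Q : Subgroup K) [Q.Normal] (y : K) :
    NormalizerFixesClasses Q y ↔
      ∀ n ∈ Subgroup.normalizer (Subgroup.zpowers y : Set K), ∀ c ∈ Subgroup.centralizer {y},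
        ∃ u ∈ Subgroup.centralizer {y}, c⁻¹ * (u * (n * c * n⁻¹) * u⁻¹) ∈ Q := by
  refine forall_congr' fun n => forall_congr' fun hn => forall_congr' fun c =>
    forall_congr' fun hc => ?_
  rw [ConjClasses.mk_eq_mk_iff_isConj, isConj_iff]
  constructor
  · rintro ⟨v, hv⟩
    obtain ⟨u, rfl⟩ := QuotientGroup.mk'_surjective _ v
    refine ⟨u, u.2, ?_⟩
    rw [← map_mul, ← map_inv, ← map_mul, eq_comm] at hv
    exact Subgroup.mem_subgroupOf.mp (QuotientGroup.eq.mp hv)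
  · rintro ⟨u, hu, h⟩
    refine ⟨QuotientGroup.mk' _ ⟨u, hu⟩, ?_⟩
    rw [← map_mul, ← map_inv, ← map_mul, eq_comm]
    exact QuotientGroup.eq.mpr (Subgroup.mem_subgroupOf.mpr h)

theorem map_prod_range_eq {Q : Type*} [CommGroup Q] (φ : Q →* Q) {q : Q} {w : ℕ → Q}
    (h0 : w 0 = 1) (hw : ∀ i, w (i + 1) = φ (w i) * q) (j : ℕ) :
    φ (∏ i ∈ Finset.range j, w i) = (∏ i ∈ Finset.range j, w i) * w j * (q ^ j)⁻¹ := by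
  induction j with
  | zero => simp [h0]
  | succ j ih =>
    rw [Finset.prod_range_succ, map_mul, ih, hw j, pow_succ, mul_inv]
    have : φ (w j) * (q * q⁻¹) = φ (w j) := by rw [mul_inv_cancel, mul_one]
    conv_lhs => rw [← this]
    simp only [mul_assoc, mul_comm, mul_left_comm]

/-- The conjugacy part of the Schur–Zassenhaus theorem for cyclic complements of an elementary
abelian group: two elements of order prime to `p` in the same coset of `Q` are conjugate under
`Q`. -/
theorem exists_conj_eq_of_mem_coset {Q : Subgroup K} [Q.Normal] {p m : ℕ} (hp : p.Prime)
    (hcomm : ∀ a ∈ Q, ∀ b ∈ Q, a * b = b * a) (hexp : ∀ a ∈ Q, a ^ p = 1) (hpm : ¬ p ∣ m)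
    {x x' : K} (hx : x ^ m = 1) (hx' : x' ^ m = 1) (hxx' : x⁻¹ * x' ∈ Q) :
    ∃ t ∈ Q, t * x' * t⁻¹ = x := by
  let _ : CommGroup Q :=
    { (inferInstance : Group Q) with mul_comm := fun a b => Subtype.ext (hcomm a a.2 b b.2) }
  let φ : Q →* Q := (MulAut.conjNormal x⁻¹ : MulAut Q).toMonoidHom
  have hφ : ∀ a : Q, (φ a : K) = x⁻¹ * a * x := by
    intro a
    change x⁻¹ * (a : K) * x⁻¹⁻¹ = _
    rw [inv_inv]
  let q : Q := ⟨x⁻¹ * x', hxx'⟩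
  have hq : (q : K) = x⁻¹ * x' := rfl
  -- the cocycle `i ↦ x⁻ⁱ x'ⁱ`
  have hmem : ∀ i : ℕ, (x ^ i)⁻¹ * x' ^ i ∈ Q := by
    intro i
    rw [← QuotientGroup.eq, QuotientGroup.mk_pow, QuotientGroup.mk_pow, QuotientGroup.eq.mpr hxx']
  let w : ℕ → Q := fun i => ⟨(x ^ i)⁻¹ * x' ^ i, hmem i⟩
  have h0 : w 0 = 1 := Subtype.ext (by simp [w])
  have hwm : w m = 1 := Subtype.ext (by simp [w, hx, hx'])
  have hw : ∀ i, w (i + 1) = φ (w i) * q := by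
    intro i
    apply Subtype.ext
    rw [Subgroup.coe_mul, hφ, hq]
    simp only [w]
    rw [pow_succ, pow_succ]
    group
  have h1 := map_prod_range_eq φ h0 hw m
  rw [hwm, mul_one] at h1
  obtain ⟨r, -, hr⟩ := Nat.exists_mul_mod_eq_one_of_coprime
    ((Nat.Prime.coprime_iff_not_dvd hp).mpr hpm).symm hp.one_lt
  set s : Q := ∏ i ∈ Finset.range m, w i
  have hqr : (q ^ m) ^ r = q := by
    apply Subtype.ext
    have hqp : (q : K) ^ p = 1 := hexp _ q.2
    rw [Subgroup.coe_pow, Subgroup.coe_pow, ← pow_mul, ← Nat.mod_add_div (m * r) p, hr, pow_add,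
      pow_mul, hqp, one_pow, mul_one, pow_one]
  have h2 : φ (s ^ r) = s ^ r * q⁻¹ := by
    rw [map_pow, h1, mul_pow, inv_pow, hqr]
  have h3 := congrArg Subtype.val h2
  rw [hφ, Subgroup.coe_mul, Subgroup.coe_inv, hq] at h3
  refine ⟨_, (s ^ r).2, ?_⟩
  have h4 : ((s ^ r : Q) : K) * x' = x * ((s ^ r : Q) : K) := by
    have h5 : ((s ^ r : Q) : K) * x = x * (((s ^ r : Q) : K) * (x⁻¹ * x')⁻¹) := by
      rw [← h3]
      group
    calc ((s ^ r : Q) : K) * x' = ((s ^ r : Q) : K) * x * (x⁻¹ * x') := by group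
      _ = x * ((s ^ r : Q) : K) := by rw [h5]; group
  rw [h4, mul_inv_cancel_right]

theorem pow_eq_self_of_modEq {g : K} {n s : ℕ} (hg : g ^ n = 1) (hs : s ≡ 1 [MOD n]) :
    g ^ s = g := by
  conv_rhs => rw [← pow_one g]
  exact pow_eq_pow_iff_modEq.mpr (hs.of_dvd (orderOf_dvd_of_pow_eq_one hg))

theorem pow_eq_one_of_dvd {g : K} {n s : ℕ} (hg : g ^ n = 1) (hs : n ∣ s) : g ^ s = 1 := by
  obtain ⟨r, rfl⟩ := hs
  rw [pow_mul, hg, one_pow]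

theorem coprime_orderOf_iff {p : ℕ} (hp : p.Prime) {y : K} (hy : y ^ p = 1) (hy1 : y ≠ 1) (t : ℕ) :
    (orderOf y).Coprime t ↔ ¬ p ∣ t := by
  have : Fact p.Prime := ⟨hp⟩
  rw [orderOf_eq_prime hy hy1, Nat.Prime.coprime_iff_not_dvd hp]

theorem isConj_pow_pow {k : ℕ} (hconj : ∀ g : K, IsConj g (g ^ k)) (g : K) (i : ℕ) :
    IsConj g (g ^ k ^ i) := by
  induction i with
  | zero => rw [pow_zero, pow_one]
  | succ i ih =>
    rw [pow_succ, pow_mul]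
    exact ih.trans (hconj _)

/-- Exponents `s ≡ 1 mod m, 0 mod p` and `s' ≡ 0 mod m, 1 mod p` for the decomposition into
commuting parts of order dividing `m` and `p`. -/
theorem exists_decomposition_exponents {p m : ℕ} (hp : p.Prime) (hpm : ¬ p ∣ m) :
    ∃ s s' : ℕ, (s ≡ 1 [MOD m] ∧ p ∣ s) ∧ (m ∣ s' ∧ s' ≡ 1 [MOD p]) ∧ s + s' ≡ 1 [MOD p * m] := by
  have hcop : Nat.Coprime m p := ((Nat.Prime.coprime_iff_not_dvd hp).mpr hpm).symm
  obtain ⟨s, hs1, hs2⟩ := Nat.chineseRemainder hcop 1 0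
  obtain ⟨s', hs1', hs2'⟩ := Nat.chineseRemainder hcop 0 1
  refine ⟨s, s', ⟨hs1, (Nat.modEq_zero_iff_dvd).mp hs2⟩,
    ⟨(Nat.modEq_zero_iff_dvd).mp hs1', hs2'⟩, ?_⟩
  rw [← Nat.modEq_and_modEq_iff_modEq_mul hcop.symm]
  exact ⟨hs2.add hs2', hs1.add hs1'⟩

/-- Every element is the product of two of its powers, one of order dividing `m` and one in `Q`. -/
theorem exists_mul_decomposition {Q : Subgroup K} {p m : ℕ} (hp : p.Prime)
    (hexp : ∀ a ∈ Q, a ^ p = 1) (hm : ∀ g : K, g ^ m ∈ Q) (hpm : ¬ p ∣ m) (g : K) :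
    ∃ s s' : ℕ, g = g ^ s * g ^ s' ∧ (g ^ s) ^ m = 1 ∧ g ^ s' ∈ Q := by
  obtain ⟨s, s', ⟨-, hs⟩, ⟨hs', -⟩, hss⟩ := exists_decomposition_exponents hp hpm
  have hg : g ^ (p * m) = 1 := by rw [mul_comm, pow_mul, hexp _ (hm g)]
  refine ⟨s, s', ?_, ?_, ?_⟩
  · rw [← pow_add, pow_eq_self_of_modEq hg hss]
  · rw [← pow_mul]
    exact pow_eq_one_of_dvd hg (mul_dvd_mul_right hs m)
  · obtain ⟨r, rfl⟩ := hs'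
    rw [pow_mul]
    exact Q.pow_mem (hm g) r

theorem conj_parts_eq {p m : ℕ} (hp : p.Prime) (hpm : ¬ p ∣ m) {x y h : K} (hxy : Commute x y)
    (hx : x ^ m = 1) (hy : y ^ p = 1) {t : ℕ} (hh : h * (x * y) * h⁻¹ = x * y ^ t) :
    h * x * h⁻¹ = x ∧ h * y * h⁻¹ = y ^ t := by
  obtain ⟨s, s', ⟨hs1, hs2⟩, ⟨hs1', hs2'⟩, -⟩ := exists_decomposition_exponents hp hpm
  have hyt : (y ^ t) ^ p = 1 := by rw [← pow_mul, mul_comm, pow_mul, hy, one_pow]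
  constructor
  · have h1 := conj_pow_mem (n := s) hh
    rwa [hxy.mul_pow, (hxy.pow_right t).mul_pow, pow_eq_self_of_modEq hx hs1,
      pow_eq_one_of_dvd hy hs2, pow_eq_one_of_dvd hyt hs2, mul_one] at h1
  · have h1 := conj_pow_mem (n := s') hh
    rwa [hxy.mul_pow, (hxy.pow_right t).mul_pow, pow_eq_self_of_modEq hy hs2',
      pow_eq_self_of_modEq hyt hs2', pow_eq_one_of_dvd hx hs1', one_mul, one_mul] at h1

variable [Finite K]

/-- Let `K` have the elementary abelian normal Sylow `p`-subgroup `Q`, and let `k` be `1` modulo the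
`p'`-part of `|K|` and a primitive root modulo `p`. Then every element of `K` is conjugate to its
`k`-th power if and only if `N_K(⟨y⟩)` induces all automorphisms of `⟨y⟩` and fixes the classes of
`C_K(y) / Q`, for each `1 ≠ y ∈ Q`. -/
theorem forall_isConj_pow_iff {Q : Subgroup K} [Q.Normal] {p m : ℕ} (hp : p.Prime)
    (hcomm : ∀ a ∈ Q, ∀ b ∈ Q, a * b = b * a) (hexp : ∀ a ∈ Q, a ^ p = 1)
    (hm : ∀ g : K, g ^ m ∈ Q) (hpm : ¬ p ∣ m) {k : ℕ}
    (hk : k ≡ 1 [MOD m]) (hpk : ¬ p ∣ k) (hgen : ∀ t : ℕ, ¬ p ∣ t → ∃ i, k ^ i ≡ t [MOD p]) :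
    (∀ g : K, IsConj g (g ^ k)) ↔
      ∀ y ∈ Q, y ≠ 1 → NormalizerInducesAut y ∧ NormalizerFixesClasses Q y := by
  constructor
  · intro hconj y hyQ hy1
    have hy := hexp y hyQ
    -- `x y` is conjugate to `x y ^ t` for `x` of order dividing `m` and any `t` prime to `p`
    have hkey : ∀ (x : K) (t : ℕ), Commute x y → x ^ m = 1 → ¬ p ∣ t →
        ∃ h : K, h * x * h⁻¹ = x ∧ h * y * h⁻¹ = y ^ t := by
      intro x t hxy hx ht
      obtain ⟨i, hi⟩ := hgen t ht
      have hki : k ^ i ≡ 1 [MOD m] := by simpa using hk.pow i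
      have hyi : y ^ k ^ i = y ^ t := by
        rw [pow_eq_pow_iff_modEq]
        exact hi.of_dvd (orderOf_dvd_of_pow_eq_one hy)
      obtain ⟨h, hh⟩ := isConj_iff.mp (isConj_pow_pow hconj (x * y) i)
      rw [hxy.mul_pow, pow_eq_self_of_modEq hx hki, hyi] at hh
      exact ⟨h, conj_parts_eq hp hpm hxy hx hy hh⟩
    refine ⟨normalizerInducesAut_of_forall_exists_conj fun t ht => ?_,
      (normalizerFixesClasses_iff Q y).mpr fun n hn c hc => ?_⟩
    · obtain ⟨h, -, hh⟩ := hkey 1 t (Commute.one_left y) (one_pow m)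
        ((coprime_orderOf_iff hp hy hy1 t).mp ht)
      exact ⟨h, hh⟩
    · obtain ⟨t, ht⟩ := exists_conj_eq_pow_of_mem_normalizer hn
      have hpt : ¬ p ∣ t := by
        intro h
        rw [pow_eq_one_of_dvd hy h, conj_eq_one_iff] at ht
        exact hy1 ht
      obtain ⟨s, s', hcs, hxm, hzQ⟩ := exists_mul_decomposition hp hexp hm hpm c
      have hcy : Commute c y := (Subgroup.mem_centralizer_singleton_iff.mp hc)
      obtain ⟨h, hh1, hh2⟩ := hkey (c ^ s) t (hcy.pow_left s) hxm hpt
      refine ⟨h * n⁻¹, ?_, ?_⟩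
      · -- `h * n⁻¹` commutes with `y ^ t`, which generates `⟨y⟩`
        have h1 : Commute (h * n⁻¹) (y ^ t) := by
          rw [commute_iff_eq]
          conv_rhs => rw [← hh2]
          rw [← ht]
          group
        obtain ⟨r, -, hr⟩ := Nat.exists_mul_mod_eq_one_of_coprime
          ((Nat.Prime.coprime_iff_not_dvd hp).mpr hpt).symm hp.one_lt
        have h2 := h1.pow_right r
        rw [← pow_mul, pow_eq_self_of_modEq hy
          (show t * r ≡ 1 [MOD p] by rw [Nat.ModEq, hr, Nat.mod_eq_of_lt hp.one_lt])] at h2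
        exact Subgroup.mem_centralizer_singleton_iff.mpr h2
      · have h1 : c⁻¹ * (h * n⁻¹ * (n * c * n⁻¹) * (h * n⁻¹)⁻¹) = c⁻¹ * (h * c * h⁻¹) := by group
        have h2 : h * c * h⁻¹ = c ^ s * (h * c ^ s' * h⁻¹) := by
          conv_lhs => rw [hcs]
          conv_rhs => rw [← hh1]
          group
        have h3 : c⁻¹ * c ^ s = (c ^ s')⁻¹ := by
          rw [inv_mul_eq_iff_eq_mul, eq_mul_inv_iff_mul_eq]
          exact hcs.symm
        rw [h1, h2, ← mul_assoc, h3]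
        exact Q.mul_mem (Q.inv_mem hzQ) (‹Q.Normal›.conj_mem _ hzQ h)
  · intro hloc g
    obtain ⟨s, s', hg, hxm, hyQ⟩ := exists_mul_decomposition hp hexp hm hpm g
    set x := g ^ s
    set y := g ^ s'
    have hxy : Commute x y := (Commute.refl g).pow_pow s s'
    have hgk : g ^ k = x * y ^ k := by
      rw [hg, hxy.mul_pow, pow_eq_self_of_modEq hxm hk]
    have hy := hexp y hyQ
    by_cases hy1 : y = 1
    · rw [hgk, hg, hy1, one_pow]
    obtain ⟨ha, hb⟩ := hloc y hyQ hy1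
    obtain ⟨n, hn⟩ := exists_conj_eq_pow_of_normalizerInducesAut
      ((coprime_orderOf_iff hp hy hy1 k).mpr hpk) ha
    obtain ⟨u, hu, huQ⟩ := (normalizerFixesClasses_iff Q y).mp hb n
      (mem_normalizer_zpowers_of_conj_eq hn) x (Subgroup.mem_centralizer_singleton_iff.mpr hxy)
    have hu' : Commute u y := Subgroup.mem_centralizer_singleton_iff.mp hu
    have hx'm : (u * (n * x * n⁻¹) * u⁻¹) ^ m = 1 := by
      rw [conj_pow, conj_pow, hxm]
      group
    obtain ⟨q, hqQ, hq⟩ := exists_conj_eq_of_mem_coset hp hcomm hexp hpm hxm hx'm huQ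
    refine isConj_iff.mpr ⟨q * u * n, ?_⟩
    have h1 : u * y ^ k * u⁻¹ = y ^ k := by
      rw [(hu'.pow_right k).eq, mul_inv_cancel_right]
    have h2 : q * y ^ k * q⁻¹ = y ^ k := by
      rw [hcomm q hqQ _ (Q.pow_mem hyQ k), mul_inv_cancel_right]
    calc q * u * n * g * (q * u * n)⁻¹
        = (q * (u * (n * x * n⁻¹) * u⁻¹) * q⁻¹) * (q * (u * (n * y * n⁻¹) * u⁻¹) * q⁻¹) := by
          conv_lhs => rw [hg]
          group
      _ = g ^ k := by rw [hq, hn, h1, h2, hgk]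

/-- For involutions the local condition holds trivially, as `N_K(⟨y⟩) = C_K(y)`. -/
theorem local_condition_of_sq_eq_one (Q : Subgroup K) [Q.Normal] {y : K} (hy : y ^ 2 = 1)
    (hy1 : y ≠ 1) : NormalizerInducesAut y ∧ NormalizerFixesClasses Q y := by
  have hodd : ∀ t : ℕ, ¬ 2 ∣ t → y ^ t = y := fun t ht =>
    pow_eq_self_of_modEq hy (Nat.odd_iff.mp (by rwa [← Nat.not_even_iff_odd, even_iff_two_dvd]))
  constructor
  · refine normalizerInducesAut_of_forall_exists_conj fun t ht => ⟨1, ?_⟩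
    rw [hodd t ((coprime_orderOf_iff Nat.prime_two hy hy1 t).mp ht)]
    group
  · rw [normalizerFixesClasses_iff]
    intro n hn c _
    obtain ⟨t, ht⟩ := exists_conj_eq_pow_of_mem_normalizer hn
    have ht2 : ¬ 2 ∣ t := by
      intro h
      rw [pow_eq_one_of_dvd hy h, conj_eq_one_iff] at ht
      exact hy1 ht
    rw [hodd t ht2, mul_inv_eq_iff_eq_mul] at ht
    refine ⟨n⁻¹, Subgroup.inv_mem _ (Subgroup.mem_centralizer_singleton_iff.mpr ht), ?_⟩
    have : c⁻¹ * (n⁻¹ * (n * c * n⁻¹) * n⁻¹⁻¹) = 1 := by group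
    rw [this]
    exact Q.one_mem

end Local

/-! ### Primitive roots -/

/-- For odd `p`, a `k` that is `1` modulo `m` and a primitive root modulo `p ^ a`: its powers
exhaust the units modulo `p ^ a * m` that are `1` modulo `m`, and the powers of `k ^ (p - 1)`
those that are `1` modulo `p * m`. -/
theorem exists_primitiveRoot {p a m : ℕ} (hp : p.Prime) (hp2 : p ≠ 2) (ha : a ≠ 0)
    (hpm : ¬ p ∣ m) : ∃ k : ℕ, k ≡ 1 [MOD m] ∧ ¬ p ∣ k ∧ k ^ (p - 1) ≡ 1 [MOD p * m] ∧
      (∀ t : ℕ, ¬ p ∣ t → ∃ i, k ^ i ≡ t [MOD p]) ∧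
      (∀ t : ℕ, t.Coprime (p ^ a * m) → t ≡ 1 [MOD m] → ∃ i, k ^ i ≡ t [MOD p ^ a * m]) ∧
      (∀ t : ℕ, t.Coprime (p ^ a * m) → t ≡ 1 [MOD p * m] →
        ∃ i, (k ^ (p - 1)) ^ i ≡ t [MOD p ^ a * m]) ∧
      ∃ i, (k ^ (p - 1)) ^ i ≡ 1 + p [MOD p ^ a] := by
  have : Fact p.Prime := ⟨hp⟩
  have hcop1 : Nat.Coprime p m := (Nat.Prime.coprime_iff_not_dvd hp).mpr hpm
  have hcop : Nat.Coprime (p ^ a) m := hcop1.pow_left a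
  have hppa : p ∣ p ^ a := dvd_pow_self p ha
  have := ZMod.isCyclic_units_of_prime_pow p hp hp2 a
  have : NeZero (p ^ a) := ⟨pow_ne_zero a hp.ne_zero⟩
  obtain ⟨g, hg⟩ := IsCyclic.exists_generator (α := (ZMod (p ^ a))ˣ)
  obtain ⟨k, hkg, hkm⟩ := Nat.chineseRemainder hcop (g : ZMod (p ^ a)).val 1
  have hkcast : (k : ZMod (p ^ a)) = g := by
    rw [(ZMod.natCast_eq_natCast_iff _ _ _).mpr hkg, ZMod.natCast_zmod_val]
  have hcoprime : ∀ t : ℕ, ¬ p ∣ t → t.Coprime (p ^ a) := fun t ht =>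
    (((Nat.Prime.coprime_iff_not_dvd hp).mpr ht).pow_left a).symm
  -- the powers of `k` exhaust the units modulo `p ^ a`
  have hgen : ∀ t : ℕ, ¬ p ∣ t → ∃ i, k ^ i ≡ t [MOD p ^ a] := by
    intro t ht
    obtain ⟨i, hi⟩ := (mem_powers_iff_mem_zpowers.mpr (hg (ZMod.unitOfCoprime t (hcoprime t ht))))
    refine ⟨i, (ZMod.natCast_eq_natCast_iff _ _ _).mp ?_⟩
    have h1 := congrArg Units.val hi
    simp only [Units.val_pow_eq_pow_val, ZMod.coe_unitOfCoprime] at h1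
    rw [Nat.cast_pow, hkcast, h1]
  have hpk : ¬ p ∣ k := by
    have h1 : k.Coprime (p ^ a) := by
      rw [← ZMod.isUnit_iff_coprime, hkcast]
      exact g.isUnit
    intro h2
    exact hp.one_lt.ne' (Nat.Coprime.eq_one_of_dvd (h1.coprime_dvd_left h2) hppa)
  have hkp : k.Coprime p := ((Nat.Prime.coprime_iff_not_dvd hp).mpr hpk).symm
  have hfermat : k ^ (p - 1) ≡ 1 [MOD p] := by
    rw [← Nat.totient_prime hp]
    exact Nat.ModEq.pow_totient hkp
  -- `k` has order `p - 1` modulo `p`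
  have hord : ∀ i, k ^ i ≡ 1 [MOD p] → p - 1 ∣ i := by
    intro i hi
    set u : (ZMod p)ˣ := ZMod.unitOfCoprime k hkp with hu
    have hgu : ∀ v : (ZMod p)ˣ, v ∈ Subgroup.zpowers u := by
      intro v
      have hv : ¬ p ∣ (v : ZMod p).val := by
        intro h
        have := (ZMod.natCast_eq_zero_iff _ _).mpr h
        rw [ZMod.natCast_zmod_val] at this
        exact v.ne_zero this
      obtain ⟨j, hj⟩ := hgen _ hv
      rw [Subgroup.mem_zpowers_iff]
      refine ⟨j, Units.ext ?_⟩
      have h1 := (ZMod.natCast_eq_natCast_iff _ _ _).mpr (hj.of_dvd hppa)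
      rw [ZMod.natCast_zmod_val] at h1
      rw [zpow_natCast, Units.val_pow_eq_pow_val, hu, ZMod.coe_unitOfCoprime, ← h1, Nat.cast_pow]
    have h2 : orderOf u = p - 1 := by
      rw [orderOf_eq_card_of_forall_mem_zpowers hgu, Nat.card_eq_fintype_card, ZMod.card_units]
    rw [← h2]
    apply orderOf_dvd_of_pow_eq_one
    apply Units.ext
    have h3 := (ZMod.natCast_eq_natCast_iff _ _ _).mpr hi
    rw [Units.val_pow_eq_pow_val, hu, ZMod.coe_unitOfCoprime, ← Nat.cast_pow, h3, Nat.cast_one,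
      Units.val_one]
  have hnot : ∀ t : ℕ, t ≡ 1 [MOD p] → ¬ p ∣ t := by
    intro t ht h
    have h1 := ((Nat.modEq_zero_iff_dvd).mpr h).symm.trans ht
    exact hp.one_lt.ne' (Nat.dvd_one.mp ((Nat.modEq_zero_iff_dvd).mp h1.symm))
  have hgen' : ∀ t : ℕ, t ≡ 1 [MOD p] → ∃ i, (k ^ (p - 1)) ^ i ≡ t [MOD p ^ a] := by
    intro t ht
    obtain ⟨i, hi⟩ := hgen t (hnot t ht)
    obtain ⟨j, rfl⟩ := hord i ((hi.of_dvd hppa).trans ht)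
    exact ⟨j, by rwa [← pow_mul]⟩
  have hkm' : ∀ i, k ^ i ≡ 1 [MOD m] := fun i => by simpa using hkm.pow i
  refine ⟨k, hkm, hpk, (Nat.modEq_and_modEq_iff_modEq_mul hcop1).mp ⟨hfermat, hkm' _⟩,
    fun t ht => ?_, fun t ht htm => ?_, fun t _ htm => ?_, hgen' _ (by simp [Nat.ModEq])⟩
  · obtain ⟨i, hi⟩ := hgen t ht
    exact ⟨i, hi.of_dvd hppa⟩
  · have hpt : ¬ p ∣ t := fun h => hp.one_lt.ne'
      (Nat.Coprime.eq_one_of_dvd (ht.coprime_dvd_left h) (hppa.trans (dvd_mul_right _ _)))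
    obtain ⟨i, hi⟩ := hgen t hpt
    exact ⟨i, (Nat.modEq_and_modEq_iff_modEq_mul hcop).mp ⟨hi, (hkm' i).trans htm.symm⟩⟩
  · obtain ⟨i, hi⟩ := hgen' t (htm.of_dvd (dvd_mul_right p m))
    refine ⟨i, (Nat.modEq_and_modEq_iff_modEq_mul hcop).mp ⟨hi, ?_⟩⟩
    rw [← pow_mul]
    exact (hkm' _).trans (htm.of_dvd (dvd_mul_left m p)).symm

/-! ### The normalizer of a Sylow subgroup modulo the Frattini subgroup -/

section Sylow

variable {G : Type*} [Group G] {p : ℕ} (P : Sylow p G)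

theorem isPGroup_sylowInNormalizer : IsPGroup p (sylowInNormalizer P) :=
  P.2.comap_subtype

theorem mk_eq_one_of_mem_frattini {u : sylowInNormalizer P}
    (hu : u ∈ frattini (sylowInNormalizer P)) :
    QuotientGroup.mk' (frattiniInNormalizer P) u = 1 :=
  (QuotientGroup.eq_one_iff _).mpr ⟨u, hu, rfl⟩

theorem index_frattiniQuotient_dvd : (frattiniQuotient P).index ∣ (P : Subgroup G).index :=
  (Subgroup.index_map_dvd _ (QuotientGroup.mk'_surjective _)).trans
    (Subgroup.relIndex_dvd_index_of_le Subgroup.le_normalizer)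

theorem frattiniQuotient_pow_index (g : localQuotient P) :
    g ^ (P : Subgroup G).index ∈ frattiniQuotient P := by
  obtain ⟨r, hr⟩ := index_frattiniQuotient_dvd P
  rw [hr, pow_mul]
  exact Subgroup.pow_mem _ (Subgroup.pow_index_mem _ g) r

variable [Finite G] [Fact p.Prime]

theorem frattiniQuotient_comm : ∀ x ∈ frattiniQuotient P, ∀ y ∈ frattiniQuotient P,
    x * y = y * x := by
  rintro _ ⟨x, hx, rfl⟩ _ ⟨y, hy, rfl⟩
  have h1 := mk_eq_one_of_mem_frattini P (commutator_mem_frattini Fact.out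
    (isPGroup_sylowInNormalizer P) (⟨x, hx⟩ : sylowInNormalizer P) ⟨y, hy⟩)
  have h2 := h1
  change QuotientGroup.mk' (frattiniInNormalizer P) (x * y * x⁻¹ * y⁻¹) = 1 at h2
  rw [map_mul, map_mul, map_mul, map_inv, map_inv, mul_inv_eq_one, mul_inv_eq_iff_eq_mul] at h2
  exact h2

theorem frattiniQuotient_pow : ∀ x ∈ frattiniQuotient P, x ^ p = 1 := by
  rintro _ ⟨x, hx, rfl⟩
  rw [← map_pow]
  exact mk_eq_one_of_mem_frattini P (pow_mem_frattini Fact.out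
    (isPGroup_sylowInNormalizer P) (⟨x, hx⟩ : sylowInNormalizer P))

end Sylow

/-! ### Characters of degree prime to `p` -/

section Main

theorem mem_IrrPrime_iff {p : ℕ} {H : Type*} [Group H] {V : Type*} [AddCommGroup V] [Module ℂ V]
    [FiniteDimensional ℂ V] {ρ : Representation ℂ H V} (hρ : ρ.IsIrreducible) :
    ρ.character ∈ IrrPrime p H ↔ ¬ p ∣ Module.finrank ℂ V := by
  constructor
  · rintro ⟨-, d, hd, hpd⟩
    rw [Representation.char_one, Nat.cast_inj] at hd
    rwa [hd]
  · exact fun h => ⟨character_mem_Irr hρ, _, Representation.char_one ρ, h⟩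

theorem isIrreducible_comp_of_surjective {H L : Type*} [Group H] [Group L] {V : Type*}
    [AddCommGroup V] [Module ℂ V] {ρ : Representation ℂ L V} (hρ : ρ.IsIrreducible) {f : H →* L}
    (hf : Function.Surjective f) : Representation.IsIrreducible (ρ.comp f) := by
  obtain ⟨hV, h⟩ := (isIrreducible_iff ρ).mp hρ
  refine (isIrreducible_iff _).mpr ⟨hV, fun W hW => h W fun g v hv => ?_⟩
  obtain ⟨x, rfl⟩ := hf g
  exact hW x v hv

theorem subset_iff_subset_of_encard_eq {α β : Type*} {A B : Set α} {A' B' : Set β} (hAB : A ⊆ B)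
    (hAB' : A' ⊆ B') (hB : B.Finite) (hB' : B'.Finite) (hA : A.encard = A'.encard)
    (hBB : B.encard = B'.encard) : B ⊆ A ↔ B' ⊆ A' := by
  constructor
  · intro h
    refine (Set.Finite.eq_of_subset_of_encard_le (hB'.subset hAB') hAB' ?_).ge
    rw [← hBB, ← hA]
    exact Set.encard_le_encard h
  · intro h
    refine (Set.Finite.eq_of_subset_of_encard_le (hB.subset hAB) hAB ?_).ge
    rw [hBB, hA]
    exact Set.encard_le_encard h

variable {G : Type*} [Group G] [Finite G] {p : ℕ} [Fact p.Prime] (P : Sylow p G)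

/-- The characters of `N_G(P)` of degree prime to `p` that are invariant under `g ↦ g ^ k'`, where
`k' = k ^ (p - 1)`, are the irreducible characters of `N_G(P) / Φ(P)`. So they are all invariant
under `g ↦ g ^ k` if and only if this map fixes the conjugacy classes of `N_G(P) / Φ(P)`. -/
theorem forall_character_pow_eq_iff_isConj {k k' : ℕ}
    (hk' : k' ≡ 1 [MOD p * (P : Subgroup G).index])
    (hkp : ∃ i, k' ^ i ≡ 1 + p [MOD Nat.card P]) :
    (∀ (d : ℕ) (ρ : Representation ℂ (Subgroup.normalizer (P : Set G)) (Fin d → ℂ)),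
      ρ.IsIrreducible → ¬ p ∣ d → (∀ g, ρ.character (g ^ k') = ρ.character g) →
        ∀ g, ρ.character (g ^ k) = ρ.character g) ↔
      ∀ g : localQuotient P, IsConj g (g ^ k) := by
  have hp : p.Prime := Fact.out
  constructor
  · intro h g
    refine isConj_of_forall_Irr fun χ hχ => ?_
    obtain ⟨d, ρ, hρ, rfl⟩ := hχ
    obtain ⟨x, rfl⟩ := QuotientGroup.mk'_surjective _ g
    have hd : ¬ p ∣ d := by
      intro hpd
      have h1 := finrank_dvd_index hρ (frattiniQuotient P) (frattiniQuotient_comm P)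
      rw [Module.finrank_fin_fun] at h1
      exact P.not_dvd_index ((hpd.trans h1).trans (index_frattiniQuotient_dvd P))
    have hinf := isIrreducible_comp_of_surjective hρ
      (QuotientGroup.mk'_surjective (frattiniInNormalizer P))
    have hchar : ∀ y, Representation.character (ρ.comp (QuotientGroup.mk' (frattiniInNormalizer P)))
        y = ρ.character (QuotientGroup.mk' (frattiniInNormalizer P) y) := fun y => rfl
    have h2 := h d _ hinf hd (fun y => by
      rw [hchar, hchar, map_pow]
      congr 1
      refine pow_eq_self_of_modEq ?_ hk'
      rw [mul_comm, pow_mul]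
      exact frattiniQuotient_pow P _ (frattiniQuotient_pow_index P _)) x
    rw [hchar, hchar, map_pow] at h2
    exact h2.symm
  · intro hconj d ρ hρ hd hρk g
    obtain ⟨i, hi⟩ := hkp
    have htriv : ∀ u ∈ frattiniInNormalizer P, ρ u = 1 := by
      intro u hu
      refine frattini_acts_trivially hρ hp (sylowInNormalizer P) (isPGroup_sylowInNormalizer P)
        (by rwa [Module.finrank_fin_fun]) (fun w hw => ?_) hu
      have hwP : w ^ Nat.card P = 1 := by
        have h1 := congrArg Subtype.val
          (pow_card_eq_one' (x := (⟨w, Subgroup.mem_subgroupOf.mp hw⟩ : (P : Subgroup G))))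
        exact Subtype.ext h1
      have h1 : w ^ (1 + p) = w ^ k' ^ i :=
        pow_eq_pow_iff_modEq.mpr (hi.symm.of_dvd (orderOf_dvd_of_pow_eq_one hwP))
      rw [h1, character_pow_pow ρ hρk]
    obtain ⟨c, hc⟩ := isConj_iff.mp (hconj (QuotientGroup.mk' _ g))
    obtain ⟨y, rfl⟩ := QuotientGroup.mk'_surjective _ c
    rw [← map_mul, ← map_inv, ← map_mul, ← map_pow] at hc
    have h1 := htriv _ (QuotientGroup.eq.mp hc)
    have h2 : ρ (g ^ k) = ρ (y * g * y⁻¹) := by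
      rw [← mul_inv_cancel_left (y * g * y⁻¹) (g ^ k), map_mul, h1, mul_one]
    rw [← Representation.char_conj ρ g y, Representation.character, h2]
    rfl

end Main

end McKayGap
end

open McKayGap in
theorem corollary5p6 {G : Type*} [Group G] [Finite G] (p : ℕ) [Fact p.Prime] (P : Sylow p G)
    (hMN : SatisfiesMcKayNavarro P) :
    (∀ χ ∈ IrrPrime p G, IsAlmostPRational p χ → IsPRational p χ) ↔
      ∀ y ∈ frattiniQuotient P, y ≠ 1 →
        NormalizerInducesAut y ∧ NormalizerFixesClasses (frattiniQuotient P) y := by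
  have hp : p.Prime := Fact.out
  have hpm : ¬ p ∣ (P : Subgroup G).index := P.not_dvd_index
  obtain ⟨a, ha⟩ := P.2.exists_card_eq
  set m := (P : Subgroup G).index with hm
  have hn : Nat.card G = p ^ a * m := by
    rw [← ha]
    exact (Subgroup.card_mul_index (P : Subgroup G)).symm
  have : NeZero (Nat.card G) := ⟨Nat.card_pos.ne'⟩
  have hGpow : ∀ g : G, g ^ Nat.card G = 1 := fun g => pow_card_eq_one'
  have hle : ∀ χ ∈ IrrPrime p G, valueField χ ≤ cyclo (Nat.card G) := by
    rintro _ ⟨⟨d, ρ, -, rfl⟩, -⟩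
    exact valueField_character_le_cyclo ρ hGpow
  rcases Nat.eq_zero_or_pos a with rfl | hapos
  · -- the order of `G` is prime to `p`
    refine ⟨fun _ y hy hy1 => absurd ?_ hy1, fun _ χ hχ _ => ?_⟩
    · obtain ⟨x, hx, rfl⟩ := hy
      have h1 : Subsingleton P := (Nat.card_eq_one_iff_unique.mp (by rw [ha, pow_zero])).1
      have h2 : (⟨x, Subgroup.mem_subgroupOf.mp hx⟩ : (P : Subgroup G)) = 1 :=
        Subsingleton.elim _ _
      have h3 : x = 1 := Subtype.ext (by simpa using congrArg Subtype.val h2)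
      rw [h3, map_one]
    · have h1 := hle χ hχ
      rw [hn] at h1
      exact (isPRational_iff hp hpm h1).mpr (by simpa using h1)
  by_cases hp2 : p = 2
  · subst hp2
    exact ⟨fun _ y hy hy1 => local_condition_of_sq_eq_one _ (frattiniQuotient_pow P y hy) hy1,
      fun _ χ hχ => isPRational_two_of_isAlmostPRational (NeZero.ne _) (hle χ hχ)⟩
  obtain ⟨k, hkm, hpk, hk', hgenp, hgen, hgen', hgenP⟩ :=
    exists_primitiveRoot hp hp2 hapos.ne' hpm
  rw [← hn] at hgen hgen'
  have hkn : k.Coprime (Nat.card G) := by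
    rw [hn]
    refine Nat.Coprime.mul_right (((Nat.Prime.coprime_iff_not_dvd hp).mpr hpk).pow_left a).symm ?_
    rw [Nat.Coprime, hkm.gcd_eq, Nat.gcd_one_left]
  obtain ⟨σ, hσ⟩ := exists_algEquiv_cycloRoot (Nat.card G) k hkn
  obtain ⟨τ, hτ⟩ := exists_algEquiv_cycloRoot (Nat.card G) (k ^ (p - 1)) (hkn.pow_left _)
  have hMNσ := hMN 0 σ (actsAsFrobeniusPow_zero hp hpm hn hσ hkm)
  have hMNτ := hMN 0 τ (actsAsFrobeniusPow_zero hp hpm hn hτ (hk'.of_dvd (dvd_mul_left m p)))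
  have hdm : m ∣ Nat.card G := hn ▸ dvd_mul_left m _
  have hdpm : p * m ∣ Nat.card G := hn ▸ mul_dvd_mul_right (dvd_pow_self p hapos.ne') m
  have hNpow : ∀ g : Subgroup.normalizer (P : Set G), g ^ Nat.card G = 1 :=
    fun g => Subtype.ext (hGpow g)
  have : NeZero (p * m) := ⟨fun h => NeZero.ne (Nat.card G) (Nat.eq_zero_of_zero_dvd (h ▸ hdpm))⟩
  have hmono : cyclo m ≤ cyclo (p * m) := cyclo_mono (dvd_mul_left m p)
  -- both counts of the hypothesis, for `σ` and for `τ`, compare the `p`-rational characters to the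
  -- almost `p`-rational ones
  have hkey := subset_iff_subset_of_encard_eq
    (A := {χ | χ ∈ IrrPrime p G ∧ IsGaloisInvariant σ χ})
    (B := {χ | χ ∈ IrrPrime p G ∧ IsGaloisInvariant τ χ})
    (A' := {ψ | ψ ∈ IrrPrime p (Subgroup.normalizer (P : Set G)) ∧ IsGaloisInvariant σ ψ})
    (B' := {ψ | ψ ∈ IrrPrime p (Subgroup.normalizer (P : Set G)) ∧ IsGaloisInvariant τ ψ})
    (by
      rintro _ ⟨⟨⟨d, ρ, hρ, rfl⟩, hd⟩, h⟩
      refine ⟨⟨⟨d, ρ, hρ, rfl⟩, hd⟩, ?_⟩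
      rw [isGaloisInvariant_character_iff_valueField_le ρ hGpow hdpm hk' hgen' hτ]
      exact ((isGaloisInvariant_character_iff_valueField_le ρ hGpow hdm hkm hgen hσ).mp h).trans
        hmono)
    (by
      rintro _ ⟨⟨⟨d, ρ, hρ, rfl⟩, hd⟩, h⟩
      refine ⟨⟨⟨d, ρ, hρ, rfl⟩, hd⟩, ?_⟩
      rw [isGaloisInvariant_character_iff_valueField_le ρ hNpow hdpm hk' hgen' hτ]
      exact ((isGaloisInvariant_character_iff_valueField_le ρ hNpow hdm hkm hgen hσ).mp h).trans
        hmono)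
    (finite_Irr.subset fun χ hχ => hχ.1.1) (finite_Irr.subset fun χ hχ => hχ.1.1) hMNσ hMNτ
  have hG : (∀ χ ∈ IrrPrime p G, IsAlmostPRational p χ → IsPRational p χ) ↔
      {χ | χ ∈ IrrPrime p G ∧ IsGaloisInvariant τ χ} ⊆
        {χ | χ ∈ IrrPrime p G ∧ IsGaloisInvariant σ χ} := by
    have hiff : ∀ χ ∈ IrrPrime p G, (IsAlmostPRational p χ ↔ IsGaloisInvariant τ χ) ∧
        (IsPRational p χ ↔ IsGaloisInvariant σ χ) := by
      intro χ hχ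
      have h1 := hle χ hχ
      rw [hn] at h1
      rw [isAlmostPRational_iff hp hpm h1, isPRational_iff hp hpm h1]
      obtain ⟨⟨d, ρ, hρ, rfl⟩, hd⟩ := hχ
      exact ⟨(isGaloisInvariant_character_iff_valueField_le ρ hGpow hdpm hk' hgen' hτ).symm,
        (isGaloisInvariant_character_iff_valueField_le ρ hGpow hdm hkm hgen hσ).symm⟩
    constructor
    · rintro h χ ⟨hχ, hτχ⟩
      exact ⟨hχ, (hiff χ hχ).2.mp (h χ hχ ((hiff χ hχ).1.mpr hτχ))⟩
    · intro h χ hχ halm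
      exact (hiff χ hχ).2.mpr (h ⟨hχ, (hiff χ hχ).1.mp halm⟩).2
  rw [hG, hkey, ← forall_isConj_pow_iff hp (frattiniQuotient_comm P) (frattiniQuotient_pow P)
    (frattiniQuotient_pow_index P) hpm hkm hpk hgenp,
    ← forall_character_pow_eq_iff_isConj P hk' (ha ▸ hgenP)]
  constructor
  · intro h d ρ hρ hd hρτ
    have h1 : ρ.character ∈ IrrPrime p (Subgroup.normalizer (P : Set G)) :=
      (mem_IrrPrime_iff hρ).mpr (by rwa [Module.finrank_fin_fun])
    exact (isGaloisInvariant_character_iff ρ hNpow hσ).mp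
      (h ⟨h1, (isGaloisInvariant_character_iff ρ hNpow hτ).mpr hρτ⟩).2
  · rintro h ψ ⟨hψ, hψτ⟩
    refine ⟨hψ, ?_⟩
    obtain ⟨⟨d, ρ, hρ, rfl⟩, -⟩ := id hψ
    have hd := (mem_IrrPrime_iff hρ).mp hψ
    rw [Module.finrank_fin_fun] at hd
    exact (isGaloisInvariant_character_iff ρ hNpow hσ).mpr
      (h d ρ hρ hd ((isGaloisInvariant_character_iff ρ hNpow hτ).mp hψτ))
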